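/- Let $A:[0,\infty)\to[0,\infty)$ be a Young function, i.e. $A$ is convex, $A(0)=0$, $A(1)=1$ and $A(t)\to\infty$ as $t\to\infty$, and let $\bar A(s)=\sup_{t\ge 0}(st-A(t))\in[0,\infty]$ be the complementary function. For $\Phi=A$ or $\Phi=\bar A$ and a set $E$ with $0<|E|<\infty$ put $$\|f\|_{\Phi,E}=\inf\Big\{\lambda>0:\ \frac1{|E|}\int_E \Phi\Big(\frac{|f(y)|}{\lambda}\Big)\,dy\le 1\Big\}.$$ Let $K\in L^1_{\rm loc}(\mathbb R\setminus\{0\})$ be a real-valued kernel that vanishes on $(0,\infty)$ and satisfies: (1) there is $B_1<\infty$ with $\big|\int_{\varepsilon<|x|<N}K(x)\,dx\big|\le B_1$ for all $0<\varepsilon<N$, and $\lim_{\varepsilon\to0^+}\int_{\varepsilon<|x|<N}K(x)\,dx$ exists for every $N>0$; (2) there is $B_2<\infty$ with $|K(x)|\le B_2/|x|$ for all $x\ne0$; (3) $K\in\mathcal H_{\bar A}$: there are $c,C\ge1$ such that for all $x\in\mathbb R$ and all $R>c|x|$ $$\sum_{m=1}^\infty 2^mR\,\big\|(K(x-\cdot)-K(-\cdot))\,\chi_{\{2^mR<|\cdot|\le2^{m+1}R\}}\big\|_{\bar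 A,\,B(0,2^{m+1}R)}\le C .$$ Consider locally integrable functions $f:\mathbb R\to\mathbb R$ for which the integrals $$T^+_\varepsilon f(x)=\int_{x+\varepsilon}^\infty K(x-y)f(y)\,dy$$ converge absolutely for all $x\in\mathbb R$ and $\varepsilon>0$ (for instance $f\in L^p(\mathbb R)$, $1\le p<\infty$). For every such $f$ the limit $T^+f(x)=\lim_{\varepsilon\to0^+}T^+_\varepsilon f(x)$ exists for almost every $x\in\mathbb R$. Moreover, for every $\delta\in(0,1)$ there is a finite constant $C_\delta$, independent of $f$ and $x$, such that for all such $f$ and all $x\in\mathbb R$ $$(T^+)^*f(x)\le C_\delta\big(M_\delta^+(T^+f)(x)+M_A^+f(x)\big),$$ where $(T^+)^*f(x)=\sup_{\varepsilon>0}|T^+_\varepsilon f(x)|$, $M^+g(x)=\sup_{h>0}\frac1h\int_x^{x+h}|g|$, $M_\delta^+g=(M^+(|g|^\delta))^{1/\delta}$ and $M_A^+f(x)=\sup_{h>0}\|f\|_{A,[x,x+h]}$, all with values in $[0,\infty]$. -/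

import Mathlib

open MeasureTheory Set Filter Topology
open scoped NNReal ENNReal

noncomputable section

namespace OneSided

/-- Young functions `A : [0, ∞) → [0, ∞)`: convex, `A 0 = 0`, `A 1 = 1`, `A t → ∞`. -/
structure IsYoung (A : ℝ≥0 → ℝ≥0) : Prop where
  convex : ConvexOn ℝ≥0 univ A
  map_zero : A 0 = 0
  map_one : A 1 = 1
  tendsto_atTop : Tendsto A atTop atTop

/-- The Young function complementary to `A`, namely `s ↦ sup_{t ≥ 0} (s t - A t)`. It may take the
value `∞`: for `A t = t` it is `0` on `[0, 1]` and `∞` on `(1, ∞)`. (The truncated subtraction does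
no harm, because `t = 0` contributes the value `0` to the supremum.) -/
def complementary (A : ℝ≥0 → ℝ≥0) (s : ℝ≥0) : ℝ≥0∞ :=
  ⨆ t : ℝ≥0, ((s : ℝ≥0∞) * (t : ℝ≥0∞) - (A t : ℝ≥0∞))

/-- The Luxemburg average `‖f‖_{Φ, E}`, the infimum of all `r > 0` with
`|E|⁻¹ ∫_E Φ (|f| / r) ≤ 1`; it is `∞` if there is no such `r`. -/
def luxemburg (Φ : ℝ≥0 → ℝ≥0∞) (E : Set ℝ) (f : ℝ → ℝ) : ℝ≥0∞ :=
  ⨅ (r : ℝ≥0) (_ : 0 < r) (_ : (volume E)⁻¹ * ∫⁻ y in E, Φ (‖f y‖₊ / r) ≤ 1), (r : ℝ≥0∞)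

/-- The one-sided maximal function `M⁺ f (x) = sup_{h > 0} h⁻¹ ∫_x^{x+h} |f|`. -/
def maximal (f : ℝ → ℝ) (x : ℝ) : ℝ≥0∞ :=
  ⨆ (h : ℝ) (_ : 0 < h), (ENNReal.ofReal h)⁻¹ * ∫⁻ y in Icc x (x + h), ‖f y‖ₑ

/-- `M_δ⁺ f = (M⁺ (|f|^δ))^{1/δ}`. -/
def maximalPow (δ : ℝ) (f : ℝ → ℝ) (x : ℝ) : ℝ≥0∞ :=
  maximal (fun y => |f y| ^ δ) x ^ (1 / δ)

/-- The one-sided Orlicz maximal function `M_A⁺ f (x) = sup_{h > 0} ‖f‖_{A, [x, x+h]}`. -/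
def maximalOrlicz (A : ℝ≥0 → ℝ≥0) (f : ℝ → ℝ) (x : ℝ) : ℝ≥0∞ :=
  ⨆ (h : ℝ) (_ : 0 < h), luxemburg (fun t => (A t : ℝ≥0∞)) (Icc x (x + h)) f

/-- Kernels of one-sided singular integrals, apart from the smoothness condition: locally integrable
away from the origin, supported in the negative half-line, with the cancellation and the size
condition. -/
structure IsSingularKernel (K : ℝ → ℝ) : Prop where
  locallyIntegrable : LocallyIntegrableOn K {0}ᶜ volume
  support : ∀ x, 0 < x → K x = 0
  cancellation : ∃ B : ℝ, ∀ ε N : ℝ, 0 < ε → ε < N →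
    |∫ x in {x : ℝ | ε < |x| ∧ |x| < N}, K x| ≤ B
  limit : ∀ N : ℝ, 0 < N → ∃ l : ℝ,
    Tendsto (fun ε : ℝ => ∫ x in {x : ℝ | ε < |x| ∧ |x| < N}, K x) (𝓝[>] 0) (𝓝 l)
  size : ∃ B : ℝ, ∀ x, x ≠ 0 → |K x| ≤ B / |x|

/-- The `L^Φ`-Hörmander condition `K ∈ H_Φ`. The sum over `m ≥ 1` is written with `m + 1`,
`m : ℕ`. -/
def Hormander (Φ : ℝ≥0 → ℝ≥0∞) (K : ℝ → ℝ) : Prop :=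
  ∃ c C : ℝ≥0, 1 ≤ c ∧ 1 ≤ C ∧ ∀ x R : ℝ, (c : ℝ) * |x| < R →
    ∑' m : ℕ, ENNReal.ofReal (2 ^ (m + 1) * R) *
      luxemburg Φ (Metric.ball 0 (2 ^ (m + 2) * R))
        ({y : ℝ | 2 ^ (m + 1) * R < |y| ∧ |y| ≤ 2 ^ (m + 2) * R}.indicator
          fun y => K (x - y) - K (-y)) ≤ (C : ℝ≥0∞)

/-- The truncated operator `T_ε⁺ f (x) = ∫_{x+ε}^∞ K (x - y) f(y) dy`. -/
def truncated (K : ℝ → ℝ) (ε : ℝ) (f : ℝ → ℝ) (x : ℝ) : ℝ :=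
  ∫ y in Ioi (x + ε), K (x - y) * f y

/-- The one-sided singular integral `T⁺ f (x) = lim_{ε → 0⁺} T_ε⁺ f (x)` (an unspecified number at
points where the limit does not exist). -/
def singularIntegral (K : ℝ → ℝ) (f : ℝ → ℝ) (x : ℝ) : ℝ :=
  limUnder (𝓝[>] (0 : ℝ)) fun ε => truncated K ε f x

/-- The maximal singular integral `(T⁺)^* f (x) = sup_{ε > 0} |T_ε⁺ f (x)|`. -/
def maximalSingularIntegral (K : ℝ → ℝ) (f : ℝ → ℝ) (x : ℝ) : ℝ≥0∞ :=
  ⨆ (ε : ℝ) (_ : 0 < ε), ‖truncated K ε f x‖ₑ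

/-- The functions on which the operators are considered: locally integrable functions for which all
the truncated integrals converge absolutely. By the size condition on the kernel, every function in
`L^p`, `1 ≤ p < ∞`, is of this kind. -/
structure Admissible (K f : ℝ → ℝ) : Prop where
  locallyIntegrable : LocallyIntegrable f volume
  integrableOn : ∀ x ε : ℝ, 0 < ε → IntegrableOn (fun y => K (x - y) * f y) (Ioi (x + ε)) volume

end OneSided

end

/-!
The proof compares the truncation `T_ε⁺ f (x)` with `T⁺ f (z)` for `z` in a short interval to the
right of `x`, of length comparable to `ε`. The two numbers differ by a far part and a near part. The
far part is the change of `∫_{y > x + ε} K (· - y) f y` between `x` and `z`; Hölder's inequality for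
the pair `A`, `complementary A` on dyadic annuli and the Hörmander condition bound it by the Orlicz
maximal function (`abs_truncated_sub_le`). The near part is the singular integral of
`f` restricted to `(x, x + ε]`; by the weak type `(1, 1)` inequality it is bounded by a mean of
`|f|` outside at most half of the interval. Hence `|T⁺ f|` is at least half as large as
`|T_ε⁺ f (x)|` on half of the interval whenever the latter is large compared with the Orlicz maximal
function (`abs_truncated_le`), and Chebyshev's inequality for `|T⁺ f| ^ δ` gives the claim.

Both this argument and the almost everywhere convergence rest on the weak type `(1, 1)` inequality
for the maximal singular integral (`IsSingularKernel.exists_volume_maximal_gt_le`). It is proved for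
kernels truncated near `0` and `∞`, with constants that do not depend on the truncation
(`IsTruncatedKernel`); since `A 1 = 1`, these kernels satisfy the `L¹` Hörmander condition.
Cancellation, size and Hörmander condition bound the Fourier transform of the kernel, and Plancherel's
theorem gives `L²` boundedness. A function is then split by a Calderón-Zygmund decomposition. For
the bounded part, the maximal truncation is controlled by the maximal function of the square of the
operator (`IsTruncatedKernel.exists_average_gt_of_bounded`). For the part with mean zero, the
Hörmander condition controls the intervals that a truncation does not cut, and the size condition
the single interval that it cuts (`IsTruncatedKernel.enorm_truncated_le_oscillation`). So the
maximal operator is treated directly, without a Cotlar inequality for integrable functions, which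
the `L¹` Hörmander condition alone would not provide.
-/

namespace OneSided

/-! ### The one-sided maximal function -/

/-- The weak type `(1, 1)` inequality for the one-sided maximal function, as a bound for the outer
measure of the set where some average to the right exceeds `lam`. -/
theorem volume_exists_average_gt_le (F : ℝ → ℝ≥0∞) {lam : ℝ} (hlam : 0 < lam) :
    volume {x : ℝ | ∃ h : ℝ, 0 < h ∧ ENNReal.ofReal (lam * h) < ∫⁻ y in Icc x (x + h), F y}
      ≤ ENNReal.ofReal (5 / lam) * ∫⁻ y, F y := by
  by_cases hF : ∫⁻ y, F y = ∞
  · rw [hF, ENNReal.mul_top (ENNReal.ofReal_pos.2 (by positivity)).ne']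
    exact le_top
  set E := {x : ℝ | ∃ h : ℝ, 0 < h ∧ ENNReal.ofReal (lam * h) < ∫⁻ y in Icc x (x + h), F y}
    with hE
  have hE' : ∀ x : E, ∃ h : ℝ, 0 < h ∧
      ENNReal.ofReal (lam * h) < ∫⁻ y in Icc (x : ℝ) (x + h), F y := fun x => x.2
  choose h hpos hav using hE'
  have hball : ∀ x : E, Metric.closedBall ((x : ℝ) + h x / 2) (h x / 2)
      = Icc (x : ℝ) (x + h x) := by
    intro x
    rw [Real.closedBall_eq_Icc]
    congr 1 <;> ring
  obtain ⟨u, -, hdisj, hcov⟩ := Vitali.exists_disjoint_subfamily_covering_enlargement_closedBall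
    (univ : Set E) (fun x => (x : ℝ) + h x / 2) (fun x => h x / 2)
    ((∫⁻ y, F y).toReal / lam / 2) (fun x _ => by
      have h1 : ENNReal.ofReal (lam * h x) ≤ ∫⁻ y, F y :=
        (hav x).le.trans (setLIntegral_le_lintegral _ _)
      have h2 : lam * h x ≤ (∫⁻ y, F y).toReal := (ENNReal.ofReal_le_iff_le_toReal hF).1 h1
      have : h x ≤ (∫⁻ y, F y).toReal / lam := by
        rw [le_div_iff₀ hlam]; linarith
      linarith) 5 (by norm_num)
  have hcount : u.Countable := by
    refine hdisj.countable_of_nonempty_interior fun x _ => ?_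
    rw [hball, interior_Icc]
    exact nonempty_Ioo.2 (by linarith [hpos x])
  calc volume E
      ≤ volume (⋃ x ∈ u, Metric.closedBall ((x : ℝ) + h x / 2) (5 * (h x / 2))) := by
        refine measure_mono fun x hx => ?_
        obtain ⟨b, hb, hsub⟩ := hcov ⟨x, hx⟩ (mem_univ _)
        refine mem_iUnion₂.2 ⟨b, hb, hsub ?_⟩
        rw [hball]
        exact ⟨le_rfl, by linarith [hpos ⟨x, hx⟩]⟩
    _ ≤ ∑' x : u, volume (Metric.closedBall (((x : E) : ℝ) + h x / 2) (5 * (h x / 2))) :=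
        measure_biUnion_le _ hcount _
    _ ≤ ∑' x : u, ENNReal.ofReal (5 / lam) * ∫⁻ y in Icc ((x : E) : ℝ) (x + h x), F y := by
        refine ENNReal.tsum_le_tsum fun x => ?_
        rw [Real.volume_closedBall]
        refine le_trans (le_of_eq ?_) (mul_le_mul_right (hav x).le _)
        rw [← ENNReal.ofReal_mul (by positivity)]
        congr 1
        field_simp
    _ = ENNReal.ofReal (5 / lam) * ∑' x : u, ∫⁻ y in Icc ((x : E) : ℝ) (x + h x), F y :=
        ENNReal.tsum_mul_left
    _ = ENNReal.ofReal (5 / lam) * ∫⁻ y in ⋃ x ∈ u, Icc ((x : E) : ℝ) (x + h x), F y := by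
        rw [lintegral_biUnion hcount (fun _ _ => measurableSet_Icc)]
        intro x hx y hy hxy
        have := hdisj hx hy hxy
        simpa only [Function.onFun, hball] using this
    _ ≤ _ := by gcongr; exact Measure.restrict_le_self

/-! ### Calderón-Zygmund intervals -/

/-- The stopping-time selection of Calderón and Zygmund, stopped at scale `h`. Intervals are
encoded as pairs (left endpoint, length). If the mean of `F` over an interval of length `2 ^ n * h`
is at most `lam`, repeated halving selects disjoint subintervals with mean in `(lam, 2 * lam]`, and
every unselected point lies in an interval of length `h` over which the mean is at most `lam`. -/
theorem exists_stopping_intervals {F : ℝ → ℝ≥0∞} {lam h : ℝ} (hh : 0 < h) (n : ℕ) :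
    ∀ a : ℝ, ∫⁻ y in Ico a (a + 2 ^ n * h), F y ≤ ENNReal.ofReal (lam * (2 ^ n * h)) →
    ∃ S : Finset (ℝ × ℝ),
      ((S : Set (ℝ × ℝ)).PairwiseDisjoint fun p => Ico p.1 (p.1 + p.2)) ∧
      (∀ p ∈ S, 0 < p.2 ∧ Ico p.1 (p.1 + p.2) ⊆ Ico a (a + 2 ^ n * h) ∧
        ENNReal.ofReal (lam * p.2) < ∫⁻ y in Ico p.1 (p.1 + p.2), F y ∧
        ∫⁻ y in Ico p.1 (p.1 + p.2), F y ≤ ENNReal.ofReal (2 * lam * p.2)) ∧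
      ∀ x ∈ Ico a (a + 2 ^ n * h), (∀ p ∈ S, x ∉ Ico p.1 (p.1 + p.2)) →
        ∃ q, x ∈ Ico q (q + h) ∧ ∫⁻ y in Ico q (q + h), F y ≤ ENNReal.ofReal (lam * h) := by
  induction n with
  | zero =>
    intro a ha
    refine ⟨∅, by simp, by simp, fun x hx _ => ⟨a, ?_, ?_⟩⟩
    · simpa using hx
    · simpa using ha
  | succ n ih =>
    intro a ha
    -- It suffices to treat each half separately: a half with large mean is selected itself.
    have half : ∀ b : ℝ, Ico b (b + 2 ^ n * h) ⊆ Ico a (a + 2 ^ (n + 1) * h) →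
        ∃ S : Finset (ℝ × ℝ),
        ((S : Set (ℝ × ℝ)).PairwiseDisjoint fun p => Ico p.1 (p.1 + p.2)) ∧
        (∀ p ∈ S, 0 < p.2 ∧ Ico p.1 (p.1 + p.2) ⊆ Ico b (b + 2 ^ n * h) ∧
          ENNReal.ofReal (lam * p.2) < ∫⁻ y in Ico p.1 (p.1 + p.2), F y ∧
          ∫⁻ y in Ico p.1 (p.1 + p.2), F y ≤ ENNReal.ofReal (2 * lam * p.2)) ∧
        ∀ x ∈ Ico b (b + 2 ^ n * h), (∀ p ∈ S, x ∉ Ico p.1 (p.1 + p.2)) →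
          ∃ q, x ∈ Ico q (q + h) ∧ ∫⁻ y in Ico q (q + h), F y ≤ ENNReal.ofReal (lam * h) := by
      intro b hb
      by_cases hav : ∫⁻ y in Ico b (b + 2 ^ n * h), F y ≤ ENNReal.ofReal (lam * (2 ^ n * h))
      · exact ih b hav
      · refine ⟨{(b, 2 ^ n * h)}, by simp, ?_, ?_⟩
        · intro p hp
          rw [Finset.mem_singleton] at hp
          subst hp
          refine ⟨by positivity, subset_rfl, not_le.1 hav, ?_⟩
          refine (lintegral_mono_set hb).trans (ha.trans (le_of_eq ?_))
          congr 1
          ring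
        · intro x hx hx'
          exact absurd hx (hx' _ (Finset.mem_singleton_self _))
    have e : a + 2 ^ (n + 1) * h = a + 2 ^ n * h + 2 ^ n * h := by ring
    have hp : 0 < 2 ^ n * h := by positivity
    obtain ⟨S, hS1, hS2, hS3⟩ := half a (Ico_subset_Ico_right (by linarith))
    obtain ⟨S', hS1', hS2', hS3'⟩ := half (a + 2 ^ n * h)
      (Ico_subset_Ico (by linarith) (by linarith))
    classical
    refine ⟨S ∪ S', ?_, ?_, ?_⟩
    · rw [Finset.coe_union, pairwiseDisjoint_union]
      refine ⟨hS1, hS1', fun p hp q hq _ => ?_⟩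
      refine Disjoint.mono (hS2 p hp).2.1 (hS2' q hq).2.1 ?_
      rw [Set.disjoint_left]
      intro x hx hx'
      exact absurd hx.2 (not_lt.2 hx'.1)
    · intro p hp
      rcases Finset.mem_union.1 hp with hp | hp
      · obtain ⟨h1, h2, h3⟩ := hS2 p hp
        exact ⟨h1, h2.trans (Ico_subset_Ico_right (by linarith)), h3⟩
      · obtain ⟨h1, h2, h3⟩ := hS2' p hp
        exact ⟨h1, h2.trans (Ico_subset_Ico (by linarith) (by linarith)), h3⟩
    · intro x hx hxS
      rcases lt_or_ge x (a + 2 ^ n * h) with hlt | hge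
      · exact hS3 x ⟨hx.1, hlt⟩ fun p hp => hxS p (Finset.mem_union_left _ hp)
      · exact hS3' x ⟨hge, by linarith [hx.2]⟩ fun p hp => hxS p (Finset.mem_union_right _ hp)

/-- The family of intervals of the Calderón-Zygmund decomposition of a continuous compactly
supported function. Continuity lets the halving stop at a finite scale, on which the function
hardly varies, so that finitely many intervals suffice. -/
theorem exists_calderonZygmund_intervals {f : ℝ → ℝ} (hf : Continuous f) (hfc : HasCompactSupport f)
    {lam : ℝ} (hlam : 0 < lam) :
    ∃ S : Finset (ℝ × ℝ),
      ((S : Set (ℝ × ℝ)).PairwiseDisjoint fun p => Ico p.1 (p.1 + p.2)) ∧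
      (∀ p ∈ S, 0 < p.2 ∧
        ENNReal.ofReal (lam * p.2) < ∫⁻ y in Ico p.1 (p.1 + p.2), ‖f y‖ₑ ∧
        ∫⁻ y in Ico p.1 (p.1 + p.2), ‖f y‖ₑ ≤ ENNReal.ofReal (2 * lam * p.2)) ∧
      ∀ x, (∀ p ∈ S, x ∉ Ico p.1 (p.1 + p.2)) → |f x| ≤ 2 * lam := by
  have huc := hfc.uniformContinuous_of_continuous hf
  obtain ⟨h, hh, hosc⟩ := Metric.uniformContinuous_iff.1 huc lam hlam
  have hint : ∫⁻ y, ‖f y‖ₑ ≠ ∞ := (hf.integrable_of_hasCompactSupport hfc).2.ne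
  obtain ⟨N, hN⟩ := hfc.isBounded.subset_closedBall 0
  -- an interval `[-2 ^ n * h, 2 ^ n * h)` containing the support, over which the mean is small
  obtain ⟨n, hn⟩ := pow_unbounded_of_one_lt
    (max (N / h) ((∫⁻ y, ‖f y‖ₑ).toReal / lam / h)) (one_lt_two : (1 : ℝ) < 2)
  have hn1 : N < 2 ^ n * h := by
    have := (le_max_left _ _).trans_lt hn
    rwa [div_lt_iff₀ hh] at this
  have hn2 : (∫⁻ y, ‖f y‖ₑ).toReal < lam * (2 ^ n * h) := by
    have := (le_max_right _ _).trans_lt hn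
    rw [div_lt_iff₀ hh, div_lt_iff₀ hlam] at this
    linarith
  have hp : 0 < 2 ^ n * h := by positivity
  obtain ⟨S, hS1, hS2, hS3⟩ := exists_stopping_intervals (F := fun y => ‖f y‖ₑ) hh (n + 1)
    (-(2 ^ n * h)) (by
      refine (setLIntegral_le_lintegral _ _).trans ?_
      rw [ENNReal.le_ofReal_iff_toReal_le hint (by positivity)]
      have : lam * (2 ^ (n + 1) * h) = 2 * (lam * (2 ^ n * h)) := by ring
      have : 0 ≤ lam * (2 ^ n * h) := by positivity
      linarith)
  refine ⟨S, hS1, fun p hp => ⟨(hS2 p hp).1, (hS2 p hp).2.2⟩, fun x hx => ?_⟩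
  by_cases hxI : x ∈ Ico (-(2 ^ n * h)) (-(2 ^ n * h) + 2 ^ (n + 1) * h)
  · obtain ⟨q, hxq, hq⟩ := hS3 x hxI hx
    by_contra! hcon
    have hlow : ∀ y ∈ Ico q (q + h), ENNReal.ofReal (|f x| - lam) ≤ ‖f y‖ₑ := by
      intro y hy
      have hd : dist x y < h := by
        rw [Real.dist_eq, abs_lt]
        constructor <;> linarith [hxq.1, hxq.2, hy.1, hy.2]
      have := hosc hd
      rw [Real.dist_eq] at this
      rw [Real.enorm_eq_ofReal_abs]
      apply ENNReal.ofReal_le_ofReal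
      have := abs_sub_abs_le_abs_sub (f x) (f y)
      linarith
    have h1 : ENNReal.ofReal (|f x| - lam) * volume (Ico q (q + h))
        ≤ ∫⁻ y in Ico q (q + h), ‖f y‖ₑ := by
      rw [← setLIntegral_const]
      exact setLIntegral_mono' measurableSet_Ico hlow
    have h2 := h1.trans hq
    rw [Real.volume_Ico, add_sub_cancel_left, ← ENNReal.ofReal_mul (by linarith),
      ENNReal.ofReal_le_ofReal_iff (by positivity)] at h2
    have := le_of_mul_le_mul_right h2 hh
    linarith
  · have : f x = 0 := by
      by_contra hne
      have hx0 := hN (subset_tsupport f hne)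
      rw [mem_closedBall_zero_iff, Real.norm_eq_abs, abs_le] at hx0
      apply hxI
      have : (2 : ℝ) ^ (n + 1) * h = 2 * (2 ^ n * h) := by ring
      constructor <;> linarith
    rw [this, abs_zero]
    positivity

/-! ### Convolutions on `L²` -/

section Convolution

open FourierTransform Convolution ContinuousLinearMap SchwartzMap

theorem lintegral_enorm_sq_fourier (φ : 𝓢(ℝ, ℂ)) :
    ∫⁻ x, ‖𝓕 φ x‖ₑ ^ 2 = ∫⁻ x, ‖φ x‖ₑ ^ 2 := by
  have key : ∀ ψ : 𝓢(ℝ, ℂ), ∫⁻ x, ‖ψ x‖ₑ ^ 2 = ENNReal.ofReal (∫ x, ‖ψ x‖ ^ 2) := by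
    intro ψ
    rw [ofReal_integral_eq_lintegral_ofReal]
    · refine lintegral_congr fun x => ?_
      rw [← ofReal_norm, ENNReal.ofReal_pow (norm_nonneg _)]
    · exact (ψ.memLp 2).integrable_norm_pow (by norm_num)
    · exact Eventually.of_forall fun x => by positivity
  rw [key, key, integral_norm_sq_fourier]

/-- Fatou's lemma for `L²` bounds. -/
theorem lintegral_enorm_sq_le_of_tendsto {u : ℕ → ℝ → ℂ} {v : ℝ → ℂ} {C : ℕ → ℝ≥0∞} {D : ℝ≥0∞}
    (hu : ∀ n, AEStronglyMeasurable (u n)) (hlim : ∀ x, Tendsto (fun n => u n x) atTop (𝓝 (v x)))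
    (hC : ∀ n, ∫⁻ x, ‖u n x‖ₑ ^ 2 ≤ C n) (hD : Tendsto C atTop (𝓝 D)) :
    ∫⁻ x, ‖v x‖ₑ ^ 2 ≤ D := by
  calc ∫⁻ x, ‖v x‖ₑ ^ 2 = ∫⁻ x, liminf (fun n => ‖u n x‖ₑ ^ 2) atTop := by
        refine lintegral_congr fun x => ?_
        refine (Tendsto.liminf_eq ?_).symm
        exact ((ENNReal.continuous_pow 2).tendsto _).comp ((continuous_enorm.tendsto _).comp (hlim x))
    _ ≤ liminf (fun n => ∫⁻ x, ‖u n x‖ₑ ^ 2) atTop :=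
        lintegral_liminf_le' fun n => (hu n).enorm.pow_const 2
    _ ≤ liminf C atTop := liminf_le_liminf (Eventually.of_forall hC)
    _ = D := hD.liminf_eq

/-- Plancherel's theorem for the convolution of Schwartz functions. -/
theorem lintegral_enorm_sq_convolution_schwartz_le (κ g : 𝓢(ℝ, ℂ)) {B : ℝ}
    (hB : ∀ ξ, ‖𝓕 κ ξ‖ ≤ B) :
    ∫⁻ x, ‖((κ : ℝ → ℂ) ⋆[mul ℂ ℂ] (g : ℝ → ℂ)) x‖ₑ ^ 2
      ≤ ENNReal.ofReal (B ^ 2) * ∫⁻ x, ‖g x‖ₑ ^ 2 := by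
  have hB0 : 0 ≤ B := (norm_nonneg _).trans (hB 0)
  calc ∫⁻ x, ‖((κ : ℝ → ℂ) ⋆[mul ℂ ℂ] (g : ℝ → ℂ)) x‖ₑ ^ 2
      = ∫⁻ x, ‖SchwartzMap.convolution (mul ℂ ℂ) κ g x‖ₑ ^ 2 := by
        simp_rw [SchwartzMap.convolution_apply]
    _ = ∫⁻ x, ‖𝓕 (SchwartzMap.convolution (mul ℂ ℂ) κ g) x‖ₑ ^ 2 :=
        (lintegral_enorm_sq_fourier _).symm
    _ ≤ ∫⁻ x, ENNReal.ofReal (B ^ 2) * ‖𝓕 g x‖ₑ ^ 2 := by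
        refine lintegral_mono fun x => ?_
        rw [SchwartzMap.fourier_convolution, SchwartzMap.pairing_apply_apply]
        rw [mul_apply', enorm_mul, mul_pow, ENNReal.ofReal_pow hB0]
        gcongr
        rw [← ofReal_norm]
        exact ENNReal.ofReal_le_ofReal (hB x)
    _ = _ := by
        rw [lintegral_const_mul' _ _ ENNReal.ofReal_ne_top, lintegral_enorm_sq_fourier]

/-- The kernel is approximated in `L¹` by smooth kernels; since `g` is bounded, the convolutions
converge pointwise. -/
theorem lintegral_enorm_sq_convolution_contDiff_le {κ g : ℝ → ℂ} (hκ : Integrable κ) {B : ℝ}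
    (hB : ∀ ξ, ‖𝓕 κ ξ‖ ≤ B) (hg : ContDiff ℝ (⊤ : ℕ∞) g) (hgc : HasCompactSupport g) :
    ∫⁻ x, ‖(κ ⋆[mul ℂ ℂ] g) x‖ₑ ^ 2 ≤ ENNReal.ofReal (B ^ 2) * ∫⁻ x, ‖g x‖ₑ ^ 2 := by
  have hB0 : 0 ≤ B := (norm_nonneg _).trans (hB 0)
  have happ : ∀ n : ℕ, ∃ k : ℝ → ℂ, HasCompactSupport k ∧ ContDiff ℝ (⊤ : ℕ∞) k ∧
      eLpNorm (κ - k) 1 volume ≤ ENNReal.ofReal (1 / ((n : ℝ) + 1)) := fun n =>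
    (memLp_one_iff_integrable.2 hκ).exist_eLpNorm_sub_le ENNReal.one_ne_top le_rfl (by positivity)
  choose k hkc hk hkn using happ
  have hki : ∀ n, Integrable (k n) := fun n => (hk n).continuous.integrable_of_hasCompactSupport
    (hkc n)
  have hL1 : ∀ n, ∫ x, ‖κ x - k n x‖ ≤ 1 / ((n : ℝ) + 1) := by
    intro n
    have h1 := hkn n
    rw [eLpNorm_one_eq_lintegral_enorm] at h1
    rw [integral_norm_eq_lintegral_enorm (f := fun x => κ x - k n x)
      (hκ.sub (hki n)).aestronglyMeasurable]
    exact ENNReal.toReal_le_of_le_ofReal (by positivity) h1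
  have hkB : ∀ n ξ, ‖𝓕 (k n) ξ‖ ≤ B + 1 / ((n : ℝ) + 1) := by
    intro n ξ
    have h1 : 𝓕 (k n) ξ = 𝓕 κ ξ - 𝓕 (κ - k n) ξ := by
      simp only [Real.fourier_eq, Pi.sub_apply, smul_sub]
      rw [integral_sub ((Real.fourierIntegral_convergent_iff ξ).2 hκ)
        ((Real.fourierIntegral_convergent_iff ξ).2 (hki n))]
      ring
    rw [h1]
    refine (norm_sub_le _ _).trans (add_le_add (hB ξ) ?_)
    refine le_trans ?_ (hL1 n)
    rw [Real.fourier_eq]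
    refine (norm_integral_le_integral_norm _).trans (le_of_eq ?_)
    simp
  obtain ⟨M, hM⟩ := hgc.exists_bound_of_continuous hg.continuous
  have hgi : Integrable g := hg.continuous.integrable_of_hasCompactSupport hgc
  have hge : ∫⁻ x, ‖g x‖ₑ ^ 2 ≠ ∞ := by
    have h1 : MemLp g 2 := hg.continuous.memLp_of_hasCompactSupport hgc
    have := h1.integrable_norm_pow (by norm_num)
    have h2 := this.2
    simp only [HasFiniteIntegral, enorm_pow, enorm_norm] at h2
    exact h2.ne
  have hconv : ∀ φ : ℝ → ℂ, Integrable φ → ∀ x, Integrable fun t => φ t * g (x - t) := by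
    intro φ hφ x
    refine hφ.mul_bdd (c := M) ?_ (Eventually.of_forall fun t => hM _)
    exact (hg.continuous.comp (continuous_const.sub continuous_id)).aestronglyMeasurable
  refine lintegral_enorm_sq_le_of_tendsto (u := fun n => k n ⋆[mul ℂ ℂ] g)
    (C := fun n : ℕ => ENNReal.ofReal ((B + 1 / ((n : ℝ) + 1)) ^ 2) * ∫⁻ x, ‖g x‖ₑ ^ 2)
    (fun n => ((hki n).integrable_convolution (mul ℂ ℂ) hgi).aestronglyMeasurable) ?_ ?_ ?_
  · intro x
    rw [tendsto_iff_norm_sub_tendsto_zero]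
    refine squeeze_zero (fun _ => norm_nonneg _) (g := fun n : ℕ => 1 / ((n : ℝ) + 1) * M)
      (fun n => ?_) ?_
    · simp only [MeasureTheory.convolution, mul_apply']
      rw [← integral_sub (hconv _ (hki n) x) (hconv _ hκ x)]
      calc ‖∫ t, (k n t * g (x - t) - κ t * g (x - t))‖
          ≤ ∫ t, ‖κ t - k n t‖ * M := by
            refine norm_integral_le_of_norm_le ((hκ.sub (hki n)).norm.mul_const M)
              (Eventually.of_forall fun t => ?_)
            rw [← sub_mul, norm_mul, norm_sub_rev]
            exact mul_le_mul_of_nonneg_left (hM _) (norm_nonneg _)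
        _ = (∫ t, ‖κ t - k n t‖) * M := integral_mul_const _ _
        _ ≤ _ := mul_le_mul_of_nonneg_right (hL1 n) ((norm_nonneg _).trans (hM 0))
    · simpa using tendsto_one_div_add_atTop_nhds_zero_nat.mul_const M
  · intro n
    exact lintegral_enorm_sq_convolution_schwartz_le ((hkc n).toSchwartzMap (hk n))
      (hgc.toSchwartzMap hg) (fun ξ => by simpa [SchwartzMap.fourier_coe] using! hkB n ξ)
  · refine ENNReal.Tendsto.mul_const ?_ (Or.inr hge)
    refine ENNReal.tendsto_ofReal ?_
    simpa using ((tendsto_one_div_add_atTop_nhds_zero_nat (𝕜 := ℝ)).const_add B).pow 2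

/-- Here `g` is approximated in `L²`; the kernel lies in `L²`, so that the convolutions converge
pointwise. -/
theorem lintegral_enorm_sq_convolution_le {κ g : ℝ → ℂ} (hκ : Integrable κ) (hκ2 : MemLp κ 2) {B : ℝ}
    (hB : ∀ ξ, ‖𝓕 κ ξ‖ ≤ B) (hg : MemLp g 2) :
    ∫⁻ x, ‖(κ ⋆[mul ℂ ℂ] g) x‖ₑ ^ 2 ≤ ENNReal.ofReal (B ^ 2) * ∫⁻ x, ‖g x‖ₑ ^ 2 := by
  have happ : ∀ n : ℕ, ∃ k : ℝ → ℂ, HasCompactSupport k ∧ ContDiff ℝ (⊤ : ℕ∞) k ∧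
      eLpNorm (g - k) 2 volume ≤ ENNReal.ofReal (1 / ((n : ℝ) + 1)) := fun n =>
    hg.exist_eLpNorm_sub_le (by norm_num) (by norm_num) (by positivity)
  choose k hkc hk hkn using happ
  have hk2 : ∀ n, MemLp (k n) 2 := fun n => (hk n).continuous.memLp_of_hasCompactSupport (hkc n)
  have hsq : ∀ φ : ℝ → ℂ, eLpNorm φ 2 volume ^ 2 = ∫⁻ x, ‖φ x‖ₑ ^ 2 := by
    intro φ
    rw [eLpNorm_eq_lintegral_rpow_enorm_toReal (by norm_num) (by norm_num)]
    simp only [ENNReal.toReal_ofNat, ENNReal.rpow_ofNat, one_div]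
    rw [← ENNReal.rpow_natCast, ← ENNReal.rpow_mul]
    norm_num
  have hzero : Tendsto (fun n : ℕ => ENNReal.ofReal (1 / ((n : ℝ) + 1))) atTop (𝓝 0) := by
    simpa using ENNReal.tendsto_ofReal (tendsto_one_div_add_atTop_nhds_zero_nat (𝕜 := ℝ))
  have hprod : ∀ φ : ℝ → ℂ, MemLp φ 2 → ∀ x, ∫⁻ t, ‖κ t * φ (x - t)‖ₑ
      ≤ eLpNorm κ 2 volume * eLpNorm φ 2 volume := by
    intro φ hφ x
    have hmp := Measure.measurePreserving_sub_left (volume : Measure ℝ) x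
    have h1 := eLpNorm_smul_le_mul_eLpNorm (p := 2) (q := 2) (r := 1)
      (hφ.aestronglyMeasurable.comp_measurePreserving hmp) hκ2.aestronglyMeasurable
    rw [eLpNorm_comp_measurePreserving hφ.aestronglyMeasurable hmp,
      eLpNorm_one_eq_lintegral_enorm] at h1
    exact h1
  have hint : ∀ φ : ℝ → ℂ, MemLp φ 2 → ∀ x, Integrable fun t => κ t * φ (x - t) := by
    intro φ hφ x
    have hmp := Measure.measurePreserving_sub_left (volume : Measure ℝ) x
    refine ⟨hκ.aestronglyMeasurable.mul (hφ.aestronglyMeasurable.comp_measurePreserving hmp), ?_⟩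
    exact (hprod φ hφ x).trans_lt (ENNReal.mul_lt_top hκ2.eLpNorm_lt_top hφ.eLpNorm_lt_top)
  refine lintegral_enorm_sq_le_of_tendsto (u := fun n => κ ⋆[mul ℂ ℂ] k n)
    (C := fun n : ℕ => ENNReal.ofReal (B ^ 2) *
      (eLpNorm g 2 volume + ENNReal.ofReal (1 / ((n : ℝ) + 1))) ^ 2)
    (fun n => (hκ.integrable_convolution (mul ℂ ℂ)
      ((hk n).continuous.integrable_of_hasCompactSupport (hkc n))).aestronglyMeasurable) ?_ ?_ ?_
  · intro x
    rw [tendsto_iff_edist_tendsto_0]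
    refine tendsto_of_tendsto_of_tendsto_of_le_of_le tendsto_const_nhds
      (h := fun n : ℕ => eLpNorm κ 2 volume * ENNReal.ofReal (1 / ((n : ℝ) + 1))) ?_
      (fun _ => zero_le) (fun n => ?_)
    · simpa using ENNReal.Tendsto.const_mul hzero (Or.inr hκ2.eLpNorm_ne_top)
    · simp only [MeasureTheory.convolution, mul_apply']
      rw [edist_comm, edist_eq_enorm_sub, ← integral_sub (hint _ hg x) (hint _ (hk2 n) x)]
      refine (enorm_integral_le_lintegral_enorm _).trans ?_
      simp_rw [← mul_sub]
      exact (hprod (g - k n) (hg.sub (hk2 n)) x).trans (mul_le_mul_right (hkn n) _)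
  · intro n
    refine (lintegral_enorm_sq_convolution_contDiff_le hκ hB (hk n) (hkc n)).trans ?_
    rw [← hsq]
    gcongr
    have : k n = g - (g - k n) := by simp
    rw [this]
    refine (eLpNorm_sub_le hg.aestronglyMeasurable (hg.sub (hk2 n)).aestronglyMeasurable
      (by norm_num)).trans ?_
    gcongr
    exact hkn n
  · rw [← hsq]
    refine ENNReal.Tendsto.const_mul ?_ (Or.inr ENNReal.ofReal_ne_top)
    have := (hzero.const_add (eLpNorm g 2 volume))
    rw [add_zero] at this
    exact ((ENNReal.continuous_pow 2).tendsto _).comp this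

/-- Convolution with an integrable kernel is bounded on `L²` by the supremum of the Fourier
transform of the kernel. -/
theorem lintegral_enorm_sq_integral_kernel_le {κ g : ℝ → ℝ} (hκ : Integrable κ) (hκ2 : MemLp κ 2)
    {B : ℝ} (hB : ∀ ξ, ‖𝓕 (fun x => (κ x : ℂ)) ξ‖ ≤ B) (hg : MemLp g 2) :
    ∫⁻ x, ‖∫ y, κ (x - y) * g y‖ₑ ^ 2 ≤ ENNReal.ofReal (B ^ 2) * ∫⁻ x, ‖g x‖ₑ ^ 2 := by
  have h := lintegral_enorm_sq_convolution_le hκ.ofReal (hκ2.ofReal (K := ℂ)) hB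
    (hg.ofReal (K := ℂ))
  refine le_trans (le_of_eq ?_) (h.trans (le_of_eq ?_))
  · refine lintegral_congr fun x => ?_
    congr 1
    rw [convolution_mul_swap]
    rw [← enorm_norm (∫ y, κ (x - y) * g y), ← Complex.norm_real, enorm_norm,
      ← integral_complex_ofReal]
    simp
  · congr 1
    refine lintegral_congr fun x => ?_
    congr 1
    rw [← enorm_norm (g x), ← Complex.norm_real, enorm_norm]
    rfl

end Convolution

/-! ### Truncated kernels and their Fourier transforms -/

/-- Bounded, compactly supported kernels that satisfy the conditions on a one-sided singular
kernel with explicit constants `c` and `B`: size, cancellation, and the `L¹` form of the Hörmander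
condition. The bound and the support do not enter any estimate quantitatively. -/
structure IsTruncatedKernel (c B : ℝ) (κ : ℝ → ℝ) : Prop where
  aesm : AEStronglyMeasurable κ volume
  support : ∀ x, 0 ≤ x → κ x = 0
  size : ∀ x, |κ x| ≤ B / |x|
  bounded : ∃ M, ∀ x, |κ x| ≤ M
  compact : ∃ N, ∀ x, x < -N → κ x = 0
  hormander : ∀ h R, c * |h| < R →
    ∫⁻ u in Ioi (2 * R), ‖κ (h - u) - κ (-u)‖ₑ ≤ ENNReal.ofReal B
  cancel : ∀ s, 0 < s → |∫ x in Ioo (-s) 0, κ x| ≤ B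

namespace IsTruncatedKernel

variable {c B : ℝ} {κ : ℝ → ℝ}

theorem nonneg (hκ : IsTruncatedKernel c B κ) : 0 ≤ B := by
  have := (abs_nonneg _).trans (hκ.size 1)
  simpa using this

theorem mul_abs_le (hκ : IsTruncatedKernel c B κ) (x : ℝ) : |κ x| * |x| ≤ B := by
  rcases eq_or_ne x 0 with rfl | hx
  · simpa using hκ.nonneg
  · have := hκ.size x
    rwa [le_div_iff₀ (abs_pos.2 hx)] at this

theorem integrable (hκ : IsTruncatedKernel c B κ) : Integrable κ := by
  obtain ⟨M, hM⟩ := hκ.bounded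
  obtain ⟨N, hN⟩ := hκ.compact
  have h1 : IntegrableOn κ (Icc (-N) 0) :=
    Measure.integrableOn_of_bounded (M := M) measure_Icc_lt_top.ne hκ.aesm
      (Eventually.of_forall fun x => by simpa using hM x)
  refine (integrableOn_iff_integrable_of_support_subset fun x hx => ?_).1 h1
  refine ⟨?_, ?_⟩
  · by_contra h
    exact hx (hN x (not_le.1 h))
  · by_contra h
    exact hx (hκ.support x (not_le.1 h).le)

theorem memLp_two (hκ : IsTruncatedKernel c B κ) : MemLp κ 2 := by
  obtain ⟨M, hM⟩ := hκ.bounded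
  rw [memLp_two_iff_integrable_sq hκ.aesm]
  simp_rw [sq]
  exact hκ.integrable.mul_bdd (c := M) hκ.aesm (Eventually.of_forall fun x => by simpa using hM x)

theorem integrable_mul_exp (hκ : IsTruncatedKernel c B κ) (ξ : ℝ) :
    Integrable fun v => Complex.exp (Complex.I * ↑(-2 * Real.pi * ξ * v)) * (κ v : ℂ) := by
  refine (hκ.integrable.ofReal (𝕜 := ℂ)).bdd_mul (c := 1) ?_ (Eventually.of_forall fun v => ?_)
  · exact Continuous.aestronglyMeasurable (by fun_prop)
  · rw [mul_comm, Complex.norm_exp_ofReal_mul_I]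

/-- Close to the singularity the oscillation is negligible and the cancellation takes over. -/
theorem norm_integral_Ioi_mul_exp_le (hκ : IsTruncatedKernel c B κ) (ξ : ℝ) {s : ℝ} (hs : 0 < s) :
    ‖∫ v in Ioi (-s), Complex.exp (Complex.I * ↑(-2 * Real.pi * ξ * v)) * (κ v : ℂ)‖
      ≤ B + 2 * Real.pi * |ξ| * B * s := by
  have hi := hκ.integrable_mul_exp ξ
  have e1 : ∫ v in Ioi (-s), Complex.exp (Complex.I * ↑(-2 * Real.pi * ξ * v)) * (κ v : ℂ)
      = ∫ v in Ioo (-s) 0, Complex.exp (Complex.I * ↑(-2 * Real.pi * ξ * v)) * (κ v : ℂ) := by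
    refine (setIntegral_eq_of_subset_of_forall_sdiff_eq_zero measurableSet_Ioi
      Ioo_subset_Ioi_self fun v hv => ?_)
    have : 0 ≤ v := by
      by_contra h
      exact hv.2 ⟨hv.1, not_le.1 h⟩
    simp [hκ.support v this]
  have e2 : ∫ v in Ioo (-s) 0, Complex.exp (Complex.I * ↑(-2 * Real.pi * ξ * v)) * (κ v : ℂ)
      = (∫ v in Ioo (-s) 0, (κ v : ℂ)) + ∫ v in Ioo (-s) 0,
        (Complex.exp (Complex.I * ↑(-2 * Real.pi * ξ * v)) - 1) * (κ v : ℂ) := by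
    have h1 : Integrable fun v => (κ v : ℂ) := hκ.integrable.ofReal
    have h2 : Integrable fun v =>
        (Complex.exp (Complex.I * ↑(-2 * Real.pi * ξ * v)) - 1) * (κ v : ℂ) := by
      simp_rw [sub_mul, one_mul]
      exact hi.sub h1
    rw [← integral_add h1.integrableOn h2.integrableOn]
    refine integral_congr_ae (Eventually.of_forall fun v => ?_)
    simp only
    ring
  rw [e1, e2]
  refine (norm_add_le _ _).trans (add_le_add ?_ ?_)
  · rw [integral_complex_ofReal, Complex.norm_real]
    exact hκ.cancel s hs
  · have h := norm_setIntegral_le_of_norm_le_const (μ := volume) (s := Ioo (-s) 0)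
      (f := fun v => (Complex.exp (Complex.I * ↑(-2 * Real.pi * ξ * v)) - 1) * (κ v : ℂ))
      (C := 2 * Real.pi * |ξ| * B) measure_Ioo_lt_top fun v _ => by
        rw [norm_mul, Complex.norm_real]
        calc _ ≤ ‖-2 * Real.pi * ξ * v‖ * ‖κ v‖ :=
              mul_le_mul_of_nonneg_right (Real.norm_exp_I_mul_ofReal_sub_one_le) (norm_nonneg _)
          _ = 2 * Real.pi * |ξ| * (|κ v| * |v|) := by
              simp only [Real.norm_eq_abs, abs_mul, abs_neg, abs_two, abs_of_pos Real.pi_pos]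
              ring
          _ ≤ _ := mul_le_mul_of_nonneg_left (hκ.mul_abs_le v) (by positivity)
    simpa [Measure.real, hs.le] using h

open FourierTransform in
/-- The Fourier transform is bounded independently of the truncation. Translating by half a period
`1 / (2 * ξ)` changes the sign of the exponential, so that far from the origin the Hörmander
condition applies. -/
theorem norm_fourier_le (hκ : IsTruncatedKernel c B κ) (hc : 1 ≤ c) (ξ : ℝ) :
    ‖𝓕 (fun x => (κ x : ℂ)) ξ‖ ≤ B * (2 + 20 * c) := by
  have hB := hκ.nonneg
  set G : ℝ → ℂ := fun v => Complex.exp (Complex.I * ↑(-2 * Real.pi * ξ * v)) * (κ v : ℂ) with hG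
  have hGi : Integrable G := hκ.integrable_mul_exp ξ
  have e0 : 𝓕 (fun x => (κ x : ℂ)) ξ = ∫ v, G v := by
    rw [Real.fourier_real_eq_integral_exp_smul]
    refine integral_congr_ae (Eventually.of_forall fun v => ?_)
    simp only [hG, smul_eq_mul]
    congr 2
    push_cast
    ring
  rw [e0]
  rcases eq_or_ne ξ 0 with rfl | hξ
  · obtain ⟨N, hN⟩ := hκ.compact
    have h1 : ∫ v, G v = ∫ v in Ioi (-(|N| + 1)), G v := by
      refine (setIntegral_eq_integral_of_forall_compl_eq_zero fun v hv => ?_).symm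
      have : v < -N := by
        have := le_abs_self N
        simp only [mem_Ioi, not_lt] at hv
        linarith
      simp [hG, hN v this]
    rw [h1]
    refine (hκ.norm_integral_Ioi_mul_exp_le 0 (by positivity)).trans ?_
    simp only [abs_zero, mul_zero, zero_mul, add_zero]
    nlinarith
  set h : ℝ := 1 / (2 * ξ) with hh
  have hh0 : 0 < |h| := abs_pos.2 (by positivity)
  have hξh : |ξ| * |h| = 1 / 2 := by
    rw [← abs_mul, hh]
    rw [show ξ * (1 / (2 * ξ)) = 1 / 2 by field_simp]
    norm_num
  have hshift : ∀ v, Complex.exp (Complex.I * ↑(-2 * Real.pi * ξ * (v + h)))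
      = -Complex.exp (Complex.I * ↑(-2 * Real.pi * ξ * v)) := by
    intro v
    have : Complex.I * ↑(-2 * Real.pi * ξ * (v + h))
        = Complex.I * ↑(-2 * Real.pi * ξ * v) - Real.pi * Complex.I := by
      have h2 : -2 * Real.pi * ξ * (v + h) = -2 * Real.pi * ξ * v - Real.pi := by
        rw [hh]; field_simp; ring
      rw [h2]; push_cast; ring
    rw [this, Complex.exp_sub, Complex.exp_pi_mul_I]
    ring
  have hGs : Integrable fun v => G (v + h) := hGi.comp_add_right h
  set r : ℝ := 5 * c * |h| with hr
  have hch : |h| ≤ c * |h| := by nlinarith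
  have hr0 : |h| < r := by rw [hr]; nlinarith
  have hrh : 0 < r - h := by linarith [le_abs_self h]
  -- twice the Fourier transform, far part and near part
  have e1 : 2 * ∫ v, G v = (∫ v in Iic (-r), (G v + G (v + h)))
      + ((∫ v in Ioi (-r), G v) + ∫ v in Ioi (-(r - h)), G v) := by
    have a1 : ∫ v, G v = ∫ v, G (v + h) := (integral_add_right_eq_self G h).symm
    have a2 : ∫ v in Ioi (-(r - h)), G v = ∫ v in Ioi (-r), G (v + h) := by
      rw [← integral_indicator measurableSet_Ioi, ← integral_indicator measurableSet_Ioi,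
        ← integral_add_right_eq_self _ h]
      refine integral_congr_ae (Eventually.of_forall fun v => ?_)
      simp only [indicator_apply, mem_Ioi]
      refine if_congr ?_ rfl rfl
      constructor <;> intro <;> linarith
    rw [a2, ← integral_add hGi.integrableOn hGs.integrableOn, ← compl_Iic,
      integral_add_compl (f := fun v => G v + G (v + h)) measurableSet_Iic (hGi.add hGs),
      integral_add hGi hGs, ← a1]
    ring
  have hfar : ‖∫ v in Iic (-r), (G v + G (v + h))‖ ≤ B := by
    have b1 : ‖∫ v in Iic (-r), (G v + G (v + h))‖ₑ ≤ ENNReal.ofReal B := by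
      refine (enorm_integral_le_lintegral_enorm _).trans ?_
      calc ∫⁻ v in Iic (-r), ‖G v + G (v + h)‖ₑ
          = ∫⁻ v in Iic (-r), ‖κ (h + v) - κ v‖ₑ := by
            refine lintegral_congr fun v => ?_
            have : G v + G (v + h)
                = -Complex.exp (Complex.I * ↑(-2 * Real.pi * ξ * v))
                  * ((κ (h + v) - κ v : ℝ) : ℂ) := by
              simp only [hG]
              rw [hshift]
              push_cast
              rw [add_comm h v]
              ring
            rw [this, enorm_mul, enorm_neg, ← enorm_norm, mul_comm Complex.I,
              Complex.norm_exp_ofReal_mul_I]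
            simp only [enorm_one, one_mul]
            rw [← enorm_norm, Complex.norm_real, enorm_norm]
        _ = ∫⁻ u in Ici r, ‖κ (h - u) - κ (-u)‖ₑ := by
            have hmp := Measure.measurePreserving_neg (volume : Measure ℝ)
            rw [← hmp.setLIntegral_comp_preimage_emb
              (Homeomorph.neg ℝ).measurableEmbedding _ (Iic (-r))]
            have : (Neg.neg : ℝ → ℝ) ⁻¹' Iic (-r) = Ici r := by
              ext u; simp
            rw [this]
            rfl
        _ ≤ ∫⁻ u in Ioi (2 * (2 * c * |h|)), ‖κ (h - u) - κ (-u)‖ₑ := by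
            refine lintegral_mono_set fun u hu => ?_
            simp only [mem_Ici, mem_Ioi, hr] at hu ⊢
            nlinarith
        _ ≤ ENNReal.ofReal B := hκ.hormander h _ (by nlinarith)
    rw [← ofReal_norm] at b1
    exact (ENNReal.ofReal_le_ofReal_iff hB).1 b1
  have hn1 := hκ.norm_integral_Ioi_mul_exp_le ξ (s := r) (by linarith)
  have hn2 := hκ.norm_integral_Ioi_mul_exp_le ξ hrh
  have b1 : 2 * Real.pi * |ξ| * B * r ≤ 20 * c * B := by
    have : 2 * Real.pi * |ξ| * B * r = 10 * Real.pi * c * B * (|ξ| * |h|) := by rw [hr]; ring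
    rw [this, hξh]
    have := Real.pi_lt_four
    have : 0 ≤ c * B := by positivity
    nlinarith
  have b2 : 2 * Real.pi * |ξ| * B * (r - h) ≤ 20 * c * B := by
    have h1 : r - h ≤ 6 * c * |h| := by rw [hr]; linarith [neg_abs_le h]
    have h2 : 2 * Real.pi * |ξ| * B * (r - h) ≤ 2 * Real.pi * |ξ| * B * (6 * c * |h|) :=
      mul_le_mul_of_nonneg_left h1 (by positivity)
    have : 2 * Real.pi * |ξ| * B * (6 * c * |h|) = 12 * Real.pi * c * B * (|ξ| * |h|) := by ring
    rw [this, hξh] at h2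
    have := Real.pi_lt_d2
    have : 0 ≤ c * B := by positivity
    nlinarith
  have h2 : 2 * ‖∫ v, G v‖ ≤ B + ((B + 20 * c * B) + (B + 20 * c * B)) := by
    have : 2 * ‖∫ v, G v‖ = ‖2 * ∫ v, G v‖ := by simp
    rw [this, e1]
    refine (norm_add_le _ _).trans (add_le_add hfar ((norm_add_le _ _).trans (add_le_add ?_ ?_)))
    · exact hn1.trans (by linarith)
    · exact hn2.trans (by linarith)
  nlinarith

theorem lintegral_enorm_sq_integral_le (hκ : IsTruncatedKernel c B κ) (hc : 1 ≤ c) {g : ℝ → ℝ}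
    (hg : MemLp g 2) :
    ∫⁻ x, ‖∫ y, κ (x - y) * g y‖ₑ ^ 2
      ≤ ENNReal.ofReal ((B * (2 + 20 * c)) ^ 2) * ∫⁻ x, ‖g x‖ₑ ^ 2 :=
  lintegral_enorm_sq_integral_kernel_le hκ.integrable hκ.memLp_two (hκ.norm_fourier_le hc) hg

end IsTruncatedKernel

/-! ### The maximal truncation of a bounded function -/

/-- Translation by `x`, which brings differences of the kernel into the form that the Hörmander
condition uses. -/
theorem lintegral_Ioi_sub_kernel_mul (K : ℝ → ℝ) (F : ℝ → ℝ≥0∞) (x z ε : ℝ) :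
    ∫⁻ y in Ioi (x + ε), ‖K (x - y) - K (z - y)‖ₑ * F y
      = ∫⁻ u in Ioi ε, ‖K (z - x - u) - K (-u)‖ₑ * F (x + u) := by
  have hmp := measurePreserving_add_left (volume : Measure ℝ) x
  rw [← hmp.setLIntegral_comp_preimage_emb (MeasurableEquiv.addLeft x).measurableEmbedding _
    (Ioi (x + ε))]
  have : (fun u => x + u) ⁻¹' Ioi (x + ε) = Ioi ε := by
    ext u; simp
  rw [this]
  refine lintegral_congr fun u => ?_
  congr 1
  rw [← enorm_neg]
  congr 1
  rw [show x - (x + u) = -u by ring, show z - (x + u) = z - x - u by ring]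
  ring

namespace IsTruncatedKernel

variable {c B : ℝ} {κ : ℝ → ℝ}

theorem aesm_comp_sub (hκ : IsTruncatedKernel c B κ) (x : ℝ) :
    AEStronglyMeasurable (fun y => κ (x - y)) volume :=
  hκ.aesm.comp_measurePreserving (Measure.measurePreserving_sub_left (volume : Measure ℝ) x)

theorem integrable_mul (hκ : IsTruncatedKernel c B κ) {g : ℝ → ℝ} (hg : Integrable g) (x : ℝ) :
    Integrable fun y => κ (x - y) * g y := by
  obtain ⟨M, hM⟩ := hκ.bounded
  exact hg.bdd_mul (c := M) (hκ.aesm_comp_sub x) (Eventually.of_forall fun y => by simpa using hM _)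

theorem aesm_prod (hκ : IsTruncatedKernel c B κ) {g : ℝ → ℝ} (hg : AEStronglyMeasurable g volume) :
    AEStronglyMeasurable (fun p : ℝ × ℝ => κ (p.1 - p.2) * g p.2) (volume.prod volume) :=
  (hκ.aesm.comp_quasiMeasurePreserving (quasiMeasurePreserving_sub volume volume)).mul
    hg.comp_snd

theorem aesm_integral (hκ : IsTruncatedKernel c B κ) {g : ℝ → ℝ}
    (hg : AEStronglyMeasurable g volume) :
    AEStronglyMeasurable (fun x => ∫ y, κ (x - y) * g y) volume :=
  (hκ.aesm_prod hg).integral_prod_right'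

/-- For a bounded function a truncation at `x` differs little from the values of the full operator
at the points `z` slightly to the right of `x`, apart from the contribution of the values of the
function on `(x, x + ε]`. -/
theorem enorm_truncated_le_of_bounded (hκ : IsTruncatedKernel c B κ) (hc : 1 ≤ c) {g : ℝ → ℝ}
    (hg : Integrable g) {L : ℝ} (hL : ∀ y, |g y| ≤ L) {x ε z : ℝ} (hε : 0 < ε)
    (hz : z ∈ Ioo x (x + ε / (2 * c))) :
    |truncated κ ε g x| ≤ B * L + |∫ y, κ (z - y) * g y|
      + |∫ y, κ (z - y) * (Ioc x (x + ε)).indicator g y| := by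
  have hL0 : 0 ≤ L := (abs_nonneg _).trans (hL 0)
  have hc0 : 0 < 2 * c := by linarith
  have hsmall : c * |z - x| < ε / 2 := by
    rw [abs_of_pos (by linarith [hz.1])]
    have : z - x < ε / (2 * c) := by linarith [hz.2]
    rw [lt_div_iff₀ hc0] at this
    linarith
  have e1 : ∫ y, κ (z - y) * g y = (∫ y, κ (z - y) * (Ioc x (x + ε)).indicator g y)
      + ∫ y in Ioi (x + ε), κ (z - y) * g y := by
    have a1 : ∫ y, κ (z - y) * g y = ∫ y in Ioi x, κ (z - y) * g y := by
      refine (setIntegral_eq_integral_of_forall_compl_eq_zero fun y hy => ?_).symm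
      rw [hκ.support _ (by simp only [mem_Ioi, not_lt] at hy; linarith [hz.1]), zero_mul]
    have a2 : ∫ y, κ (z - y) * (Ioc x (x + ε)).indicator g y
        = ∫ y in Ioc x (x + ε), κ (z - y) * g y := by
      rw [← integral_indicator measurableSet_Ioc]
      refine integral_congr_ae (Eventually.of_forall fun y => ?_)
      by_cases hy : y ∈ Ioc x (x + ε) <;> simp [hy]
    have hi := hκ.integrable_mul hg z
    rw [a1, a2, ← setIntegral_union (Ioc_disjoint_Ioi le_rfl) measurableSet_Ioi hi.integrableOn
      hi.integrableOn, Ioc_union_Ioi_eq_Ioi (by linarith)]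
  have e2 : |truncated κ ε g x - ∫ y in Ioi (x + ε), κ (z - y) * g y| ≤ B * L := by
    rw [← Real.norm_eq_abs, ← ENNReal.ofReal_le_ofReal_iff (mul_nonneg hκ.nonneg hL0), ofReal_norm,
      truncated, ← integral_sub (hκ.integrable_mul hg x).integrableOn
      (hκ.integrable_mul hg z).integrableOn]
    refine (enorm_integral_le_lintegral_enorm _).trans ?_
    calc ∫⁻ y in Ioi (x + ε), ‖κ (x - y) * g y - κ (z - y) * g y‖ₑ
        ≤ ∫⁻ y in Ioi (x + ε), ‖κ (x - y) - κ (z - y)‖ₑ * ENNReal.ofReal L := by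
          refine lintegral_mono fun y => ?_
          rw [← sub_mul, enorm_mul, Real.enorm_eq_ofReal_abs (g y)]
          exact mul_le_mul_right (ENNReal.ofReal_le_ofReal (hL y)) _
      _ = (∫⁻ u in Ioi (2 * (ε / 2)), ‖κ (z - x - u) - κ (-u)‖ₑ) * ENNReal.ofReal L := by
          rw [lintegral_Ioi_sub_kernel_mul κ (fun _ => ENNReal.ofReal L),
            lintegral_mul_const' _ _ ENNReal.ofReal_ne_top, mul_div_cancel₀ _ two_ne_zero]
      _ ≤ _ := by
          rw [ENNReal.ofReal_mul hκ.nonneg]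
          gcongr
          exact hκ.hormander _ _ hsmall
  have h1 := abs_le.1 e2
  have h2 := abs_add_le (∫ y in Ioi (x + ε), κ (z - y) * g y)
    (truncated κ ε g x - ∫ y in Ioi (x + ε), κ (z - y) * g y)
  have h3 : ∫ y in Ioi (x + ε), κ (z - y) * g y = (∫ y, κ (z - y) * g y)
    - ∫ y, κ (z - y) * (Ioc x (x + ε)).indicator g y := by rw [e1]; ring
  have h4 := abs_sub (∫ y, κ (z - y) * g y) (∫ y, κ (z - y) * (Ioc x (x + ε)).indicator g y)
  rw [← h3] at h4
  rw [add_sub_cancel] at h2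
  linarith

theorem memLp_two_of_bounded {g : ℝ → ℝ} (hg : Integrable g) {L : ℝ} (hL : ∀ y, |g y| ≤ L) :
    MemLp g 2 := by
  rw [memLp_two_iff_integrable_sq hg.aestronglyMeasurable]
  simp_rw [sq]
  exact hg.mul_bdd (c := L) hg.aestronglyMeasurable
    (Eventually.of_forall fun x => by simpa using hL x)

/-- Where the maximal truncation of a bounded function is large, the square of the full operator
has a large mean over some interval to the right: the contribution of the values near `x` can be
large only on a small part of that interval, by the `L²` bound. -/
theorem exists_average_gt_of_bounded (hκ : IsTruncatedKernel c B κ) (hc : 1 ≤ c) {g : ℝ → ℝ}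
    (hg : Integrable g) {L Λ : ℝ} (hL : ∀ y, |g y| ≤ L) (hΛ : 0 < Λ) (hΛ1 : B * L ≤ Λ)
    (hΛ2 : 8 * c * (B * (2 + 20 * c)) ^ 2 * L ^ 2 ≤ Λ ^ 2) {x ε : ℝ} (hε : 0 < ε)
    (hx : 3 * Λ < |truncated κ ε g x|) :
    ∃ h : ℝ, 0 < h ∧ ENNReal.ofReal (Λ ^ 2 / 2 * h)
      < ∫⁻ z in Icc x (x + h), ‖∫ y, κ (z - y) * g y‖ₑ ^ 2 := by
  have hL0 : 0 ≤ L := (abs_nonneg _).trans (hL 0)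
  have hc0 : 0 < 2 * c := by linarith
  set h : ℝ := ε / (2 * c) with hh
  have hh0 : 0 < h := by positivity
  refine ⟨h, hh0, ?_⟩
  set g₁ : ℝ → ℝ := (Ioc x (x + ε)).indicator g with hg₁
  have hg₁i : Integrable g₁ := hg.indicator measurableSet_Ioc
  have hg₁L : ∀ y, |g₁ y| ≤ L := by
    intro y
    by_cases hy : y ∈ Ioc x (x + ε)
    · simpa [hg₁, hy] using hL y
    · simpa [hg₁, hy] using hL0
  have markov : ∀ (φ : ℝ → ℝ) (s : Set ℝ), AEStronglyMeasurable φ volume →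
      ENNReal.ofReal (Λ ^ 2) * volume ({z | Λ ≤ |φ z|} ∩ s) ≤ ∫⁻ z in s, ‖φ z‖ₑ ^ 2 := by
    intro φ s hφ
    refine le_trans ?_ (mul_meas_ge_le_lintegral₀ (hφ.restrict.enorm.pow_const 2)
      (ENNReal.ofReal (Λ ^ 2)))
    refine mul_le_mul_right ?_ _
    refine le_trans (Measure.le_restrict_apply _ _) (measure_mono fun z hz => ?_)
    simp only [mem_ofPred_eq] at hz ⊢
    rw [Real.enorm_eq_ofReal_abs, ← ENNReal.ofReal_pow (abs_nonneg _)]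
    exact ENNReal.ofReal_le_ofReal (pow_le_pow_left₀ hΛ.le hz 2)
  have m1 := markov _ (Icc x (x + h)) (hκ.aesm_integral hg.aestronglyMeasurable)
  have m2 := markov _ univ (hκ.aesm_integral hg₁i.aestronglyMeasurable)
  rw [setLIntegral_univ, inter_univ] at m2
  have hg₁2 : ∫⁻ y, ‖g₁ y‖ₑ ^ 2 ≤ ENNReal.ofReal (L ^ 2 * ε) := by
    calc ∫⁻ y, ‖g₁ y‖ₑ ^ 2
        ≤ ∫⁻ y, (Ioc x (x + ε)).indicator (fun _ => ENNReal.ofReal (L ^ 2)) y := by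
          refine lintegral_mono fun y => ?_
          by_cases hy : y ∈ Ioc x (x + ε)
          · simp only [hy, indicator_of_mem]
            rw [Real.enorm_eq_ofReal_abs, ← ENNReal.ofReal_pow (abs_nonneg _)]
            exact ENNReal.ofReal_le_ofReal (pow_le_pow_left₀ (abs_nonneg _) (hg₁L y) 2)
          · simp [hg₁, hy]
      _ = _ := by
          rw [lintegral_indicator measurableSet_Ioc, setLIntegral_const, Real.volume_Ioc,
            add_sub_cancel_left, ENNReal.ofReal_mul (by positivity)]
  have m3 : ENNReal.ofReal (Λ ^ 2) * volume {z | Λ ≤ |∫ y, κ (z - y) * g₁ y|}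
      ≤ ENNReal.ofReal (Λ ^ 2 * h / 4) := by
    refine m2.trans ((hκ.lintegral_enorm_sq_integral_le hc
      (memLp_two_of_bounded hg₁i hg₁L)).trans ((mul_le_mul_right hg₁2 _).trans ?_))
    rw [← ENNReal.ofReal_mul (by positivity)]
    apply ENNReal.ofReal_le_ofReal
    have : (B * (2 + 20 * c)) ^ 2 * (L ^ 2 * ε)
      = (8 * c * (B * (2 + 20 * c)) ^ 2 * L ^ 2) * (h / 4) := by rw [hh]; field_simp; ring
    rw [this]
    have := mul_le_mul_of_nonneg_right hΛ2 (by positivity : 0 ≤ h / 4)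
    linarith
  have cover : Ioo x (x + h) ⊆ ({z | Λ ≤ |∫ y, κ (z - y) * g y|} ∩ Icc x (x + h))
      ∪ {z | Λ ≤ |∫ y, κ (z - y) * g₁ y|} := by
    intro z hz
    by_contra hcon
    simp only [mem_union, mem_inter_iff, mem_ofPred_eq, not_or, not_and_or, not_le] at hcon
    have h1 : |∫ y, κ (z - y) * g y| < Λ := hcon.1.resolve_right fun h => h (Ioo_subset_Icc_self hz)
    have h2 := hκ.enorm_truncated_le_of_bounded hc hg hL hε hz
    linarith [hcon.2]
  have hmeas : ENNReal.ofReal (Λ ^ 2 * h) ≤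
      (∫⁻ z in Icc x (x + h), ‖∫ y, κ (z - y) * g y‖ₑ ^ 2) + ENNReal.ofReal (Λ ^ 2 * h / 4) := by
    calc ENNReal.ofReal (Λ ^ 2 * h) = ENNReal.ofReal (Λ ^ 2) * volume (Ioo x (x + h)) := by
          rw [Real.volume_Ioo, add_sub_cancel_left, ENNReal.ofReal_mul (by positivity)]
      _ ≤ ENNReal.ofReal (Λ ^ 2) * (volume ({z | Λ ≤ |∫ y, κ (z - y) * g y|} ∩ Icc x (x + h))
          + volume {z | Λ ≤ |∫ y, κ (z - y) * g₁ y|}) :=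
          mul_le_mul_right ((measure_mono cover).trans (measure_union_le _ _)) _
      _ ≤ _ := by rw [mul_add]; exact add_le_add m1 m3
  by_contra hcon
  have := hmeas.trans (add_le_add_left (not_lt.1 hcon) _)
  rw [← ENNReal.ofReal_add (by positivity) (by positivity),
    ENNReal.ofReal_le_ofReal_iff (by positivity)] at this
  have : 0 < Λ ^ 2 * h := by positivity
  linarith

/-- The estimate for the good part of a Calderón-Zygmund decomposition. -/
theorem volume_maximal_gt_le_of_bounded (hκ : IsTruncatedKernel c B κ) (hc : 1 ≤ c) {g : ℝ → ℝ}
    (hg : Integrable g) {L Λ : ℝ} (hL : ∀ y, |g y| ≤ L) (hΛ : 0 < Λ) (hΛ1 : B * L ≤ Λ)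
    (hΛ2 : 8 * c * (B * (2 + 20 * c)) ^ 2 * L ^ 2 ≤ Λ ^ 2) :
    volume {x | ∃ ε, 0 < ε ∧ 3 * Λ < |truncated κ ε g x|}
      ≤ ENNReal.ofReal (10 * (B * (2 + 20 * c)) ^ 2 * L / Λ ^ 2) * ∫⁻ y, ‖g y‖ₑ := by
  have hL0 : 0 ≤ L := (abs_nonneg _).trans (hL 0)
  calc volume {x | ∃ ε, 0 < ε ∧ 3 * Λ < |truncated κ ε g x|}
      ≤ volume {x : ℝ | ∃ h : ℝ, 0 < h ∧ ENNReal.ofReal (Λ ^ 2 / 2 * h)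
          < ∫⁻ z in Icc x (x + h), ‖∫ y, κ (z - y) * g y‖ₑ ^ 2} := by
        refine measure_mono fun x hx => ?_
        obtain ⟨ε, hε, hxε⟩ := hx
        exact hκ.exists_average_gt_of_bounded hc hg hL hΛ hΛ1 hΛ2 hε hxε
    _ ≤ ENNReal.ofReal (5 / (Λ ^ 2 / 2)) * ∫⁻ z, ‖∫ y, κ (z - y) * g y‖ₑ ^ 2 :=
        volume_exists_average_gt_le _ (by positivity)
    _ ≤ ENNReal.ofReal (5 / (Λ ^ 2 / 2)) * (ENNReal.ofReal ((B * (2 + 20 * c)) ^ 2)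
          * (ENNReal.ofReal L * ∫⁻ y, ‖g y‖ₑ)) := by
        gcongr
        refine (hκ.lintegral_enorm_sq_integral_le hc (memLp_two_of_bounded hg hL)).trans ?_
        gcongr
        rw [← lintegral_const_mul' _ _ ENNReal.ofReal_ne_top]
        refine lintegral_mono fun y => ?_
        rw [sq]
        gcongr
        rw [Real.enorm_eq_ofReal_abs]
        exact ENNReal.ofReal_le_ofReal (hL y)
    _ = _ := by
        rw [← mul_assoc, ← mul_assoc, ← ENNReal.ofReal_mul (by positivity),
          ← ENNReal.ofReal_mul (by positivity)]
        congr 2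
        field_simp
        ring

end IsTruncatedKernel

/-! ### The maximal truncation of functions with mean zero -/

/-- The pointwise majorant of the operator applied to a function `b` that is supported in an
interval `[q, q + ℓ)` (encoded as `p = (q, ℓ)`) and has mean zero, at points where the whole
interval is seen. -/
noncomputable def oscillation (κ b : ℝ → ℝ) (p : ℝ × ℝ) (x : ℝ) : ℝ≥0∞ :=
  ∫⁻ y in Ico p.1 (p.1 + p.2), ‖κ (x - y) - κ (x - p.1)‖ₑ * ‖b y‖ₑ

namespace IsTruncatedKernel

variable {c B : ℝ} {κ : ℝ → ℝ}

theorem aemeasurable_oscillation_prod (hκ : IsTruncatedKernel c B κ) {b : ℝ → ℝ}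
    (hb : AEStronglyMeasurable b volume) (q : ℝ) :
    AEMeasurable (fun z : ℝ × ℝ => ‖κ (z.1 - z.2) - κ (z.1 - q)‖ₑ * ‖b z.2‖ₑ)
      (volume.prod volume) := by
  have h1 : AEStronglyMeasurable (fun z : ℝ × ℝ => κ (z.1 - z.2)) (volume.prod volume) :=
    hκ.aesm.comp_quasiMeasurePreserving (quasiMeasurePreserving_sub volume volume)
  have h2 : AEStronglyMeasurable (fun z : ℝ × ℝ => κ (z.1 - q)) (volume.prod volume) :=
    (hκ.aesm.comp_measurePreserving (measurePreserving_sub_right volume q)).comp_fst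
  exact (h1.sub h2).enorm.mul hb.comp_snd.enorm

theorem aemeasurable_oscillation (hκ : IsTruncatedKernel c B κ) {b : ℝ → ℝ}
    (hb : AEStronglyMeasurable b volume) (p : ℝ × ℝ) :
    AEMeasurable (oscillation κ b p) volume :=
  (((hκ.aemeasurable_oscillation_prod hb p.1).mono_ac
    (Measure.AbsolutelyContinuous.rfl.prod
      (Measure.restrict_le_self (s := Ico p.1 (p.1 + p.2))).absolutelyContinuous))).lintegral_prod_right'

/-- The Hörmander condition, integrated: away from the interval the majorant is integrable. -/
theorem lintegral_oscillation_le (hκ : IsTruncatedKernel c B κ) (hc : 1 ≤ c) {b : ℝ → ℝ}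
    (hb : AEStronglyMeasurable b volume) (p : ℝ × ℝ) (hp : 0 < p.2) :
    ∫⁻ x in Iio (p.1 - 4 * c * p.2), oscillation κ b p x
      ≤ ENNReal.ofReal B * ∫⁻ y in Ico p.1 (p.1 + p.2), ‖b y‖ₑ := by
  unfold oscillation
  rw [lintegral_lintegral_swap ((hκ.aemeasurable_oscillation_prod hb p.1).mono_ac
    ((Measure.restrict_le_self).absolutelyContinuous.prod
      (Measure.restrict_le_self).absolutelyContinuous)),
    ← lintegral_const_mul' _ _ ENNReal.ofReal_ne_top]
  refine setLIntegral_mono' measurableSet_Ico fun y hy => ?_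
  rw [lintegral_mul_const'' _ ?_]
  · gcongr
    have hmp := Measure.measurePreserving_sub_left (volume : Measure ℝ) p.1
    have hpre : (fun u => p.1 - u) ⁻¹' Iio (p.1 - 4 * c * p.2) = Ioi (2 * (2 * c * p.2)) := by
      ext u
      simp only [mem_preimage, mem_Iio, mem_Ioi]
      constructor <;> intro <;> linarith
    rw [← hmp.setLIntegral_comp_preimage_emb (Homeomorph.subLeft p.1).measurableEmbedding _
      (Iio (p.1 - 4 * c * p.2)), hpre]
    calc ∫⁻ u in Ioi (2 * (2 * c * p.2)), ‖κ (p.1 - u - y) - κ (p.1 - u - p.1)‖ₑ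
        = ∫⁻ u in Ioi (2 * (2 * c * p.2)), ‖κ (p.1 - y - u) - κ (-u)‖ₑ := by
          refine lintegral_congr fun u => ?_
          rw [show p.1 - u - y = p.1 - y - u by ring, show p.1 - u - p.1 = -u by ring]
      _ ≤ _ := by
          refine hκ.hormander _ _ ?_
          have : |p.1 - y| ≤ p.2 := by
            rw [abs_le]; constructor <;> linarith [hy.1, hy.2]
          nlinarith
  · exact ((hκ.aesm.comp_measurePreserving (measurePreserving_sub_right volume y)).sub
      (hκ.aesm.comp_measurePreserving (measurePreserving_sub_right volume p.1))).restrict.enorm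

/-- Outside a dilate of its interval, a truncation applied to a function with mean zero is
controlled by the oscillation of the kernel; only if the truncation cuts the interval, the size of
the kernel has to be used. -/
theorem enorm_truncated_le_oscillation (hκ : IsTruncatedKernel c B κ) (hc : 1 ≤ c) {b : ℝ → ℝ}
    (hb : Integrable b) {p : ℝ × ℝ} (hp : 0 < p.2)
    (hsupp : ∀ y, y ∉ Ico p.1 (p.1 + p.2) → b y = 0) (hmean : ∫ y, b y = 0) {lam : ℝ}
    (hsize : ∫⁻ y in Ico p.1 (p.1 + p.2), ‖b y‖ₑ ≤ ENNReal.ofReal (4 * lam * p.2)) {x ε : ℝ}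
    (hε : 0 < ε) (hx : x ∉ Ico (p.1 - 4 * c * p.2) (p.1 + p.2)) :
    ‖truncated κ ε b x‖ₑ ≤ (Iio (p.1 - 4 * c * p.2)).indicator (oscillation κ b p) x
      + (Ico p.1 (p.1 + p.2)).indicator (fun _ => ENNReal.ofReal (4 * B * lam)) (x + ε) := by
  have hzero : ∀ y, y ∉ Ico p.1 (p.1 + p.2) → κ (x - y) * b y = 0 := fun y hy => by
    rw [hsupp y hy, mul_zero]
  have hcp : p.2 ≤ 4 * c * p.2 := by nlinarith
  rcases le_or_gt (p.1 + p.2) (x + ε) with h1 | h1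
  · have : truncated κ ε b x = 0 := by
      refine setIntegral_eq_zero_of_forall_eq_zero fun y hy => hzero y fun hy' => ?_
      exact absurd (hy'.2.trans_le h1) (not_lt.2 (le_of_lt hy))
    simp [this]
  have hx1 : x < p.1 - 4 * c * p.2 := by
    by_contra h
    exact hx ⟨not_lt.1 h, by linarith⟩
  rcases lt_or_ge (x + ε) p.1 with h2 | h2
  · rw [indicator_of_mem (show x ∈ Iio (p.1 - 4 * c * p.2) from hx1)]
    refine le_add_right ?_
    have e1 : truncated κ ε b x = ∫ y in Ico p.1 (p.1 + p.2), (κ (x - y) - κ (x - p.1)) * b y := by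
      have a1 : truncated κ ε b x = ∫ y in Ico p.1 (p.1 + p.2), κ (x - y) * b y :=
        setIntegral_eq_of_subset_of_forall_sdiff_eq_zero measurableSet_Ioi
          (fun y hy => lt_of_lt_of_le h2 hy.1) fun y hy => hzero y hy.2
      have a2 : ∫ y in Ico p.1 (p.1 + p.2), κ (x - p.1) * b y = 0 := by
        rw [integral_const_mul, setIntegral_eq_integral_of_forall_compl_eq_zero hsupp, hmean,
          mul_zero]
      rw [a1, ← sub_zero (∫ y in Ico p.1 (p.1 + p.2), κ (x - y) * b y), ← a2,
        ← integral_sub (hκ.integrable_mul hb x).integrableOn (hb.const_mul _).integrableOn]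
      refine integral_congr_ae (Eventually.of_forall fun y => ?_)
      simp only
      ring
    rw [e1]
    refine (enorm_integral_le_lintegral_enorm _).trans (le_of_eq ?_)
    exact lintegral_congr fun y => enorm_mul _ _
  · rw [indicator_of_mem (show x + ε ∈ Ico p.1 (p.1 + p.2) from ⟨h2, h1⟩)]
    refine le_add_left ?_
    rw [truncated, ← integral_indicator measurableSet_Ioi]
    refine (enorm_integral_le_lintegral_enorm _).trans ?_
    calc ∫⁻ y, ‖(Ioi (x + ε)).indicator (fun y => κ (x - y) * b y) y‖ₑ
        ≤ ∫⁻ y, (Ico p.1 (p.1 + p.2)).indicator (fun y => ENNReal.ofReal (B / p.2) * ‖b y‖ₑ) y := by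
          refine lintegral_mono fun y => ?_
          by_cases hy : y ∈ Ico p.1 (p.1 + p.2)
          · rw [indicator_of_mem hy, enorm_indicator_eq_indicator_enorm]
            refine (indicator_le_self _ _ y).trans ?_
            rw [enorm_mul, Real.enorm_eq_ofReal_abs (κ _)]
            gcongr
            refine (hκ.size _).trans ?_
            refine div_le_div_of_nonneg_left hκ.nonneg hp ?_
            rw [abs_sub_comm, abs_of_pos (by linarith [hy.1])]
            linarith [hy.1]
          · simp [hy, hzero y hy]
      _ = ENNReal.ofReal (B / p.2) * ∫⁻ y in Ico p.1 (p.1 + p.2), ‖b y‖ₑ := by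
          rw [lintegral_indicator measurableSet_Ico, lintegral_const_mul' _ _ ENNReal.ofReal_ne_top]
      _ ≤ ENNReal.ofReal (B / p.2) * ENNReal.ofReal (4 * lam * p.2) := by gcongr
      _ = _ := by
          rw [← ENNReal.ofReal_mul (div_nonneg hκ.nonneg hp.le)]
          congr 1
          field_simp

theorem truncated_sum (hκ : IsTruncatedKernel c B κ) {ι : Type*} (S : Finset ι) {b : ι → ℝ → ℝ}
    (hb : ∀ i ∈ S, Integrable (b i)) (ε x : ℝ) :
    truncated κ ε (fun y => ∑ i ∈ S, b i y) x = ∑ i ∈ S, truncated κ ε (b i) x := by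
  simp only [truncated, Finset.mul_sum]
  exact integral_finsetSum _ fun i hi => (hκ.integrable_mul (hb i hi) x).integrableOn

/-- The estimate for the bad part of a Calderón-Zygmund decomposition at height `lam`. -/
theorem volume_maximal_sum_gt_le (hκ : IsTruncatedKernel c B κ) (hc : 1 ≤ c) {lam : ℝ}
    (hlam : 0 < lam) (S : Finset (ℝ × ℝ)) {b : ℝ × ℝ → ℝ → ℝ}
    (hdisj : (S : Set (ℝ × ℝ)).PairwiseDisjoint fun p => Ico p.1 (p.1 + p.2))
    (hpos : ∀ p ∈ S, 0 < p.2) (hb : ∀ p ∈ S, Integrable (b p))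
    (hsupp : ∀ p ∈ S, ∀ y, y ∉ Ico p.1 (p.1 + p.2) → b p y = 0)
    (hmean : ∀ p ∈ S, ∫ y, b p y = 0)
    (hsize : ∀ p ∈ S, ∫⁻ y in Ico p.1 (p.1 + p.2), ‖b p y‖ₑ ≤ ENNReal.ofReal (4 * lam * p.2)) :
    volume {x | ∃ ε, 0 < ε ∧ (4 * B + 1) * lam < |truncated κ ε (fun y => ∑ p ∈ S, b p y) x|}
      ≤ ENNReal.ofReal (4 * c + 1 + 4 * B) * ∑ p ∈ S, ENNReal.ofReal p.2 := by
  have hB := hκ.nonneg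
  set D : ℝ → ℝ≥0∞ := fun x => ∑ p ∈ S,
    (Iio (p.1 - 4 * c * p.2)).indicator (oscillation κ (b p) p) x with hD
  have hDm : ∀ p ∈ S, AEMeasurable
      ((Iio (p.1 - 4 * c * p.2)).indicator (oscillation κ (b p) p)) volume := fun p hp =>
    (hκ.aemeasurable_oscillation (hb p hp).aestronglyMeasurable p).indicator measurableSet_Iio
  have cover : {x | ∃ ε, 0 < ε ∧
      (4 * B + 1) * lam < |truncated κ ε (fun y => ∑ p ∈ S, b p y) x|}
      ⊆ (⋃ p ∈ S, Ico (p.1 - 4 * c * p.2) (p.1 + p.2)) ∪ {x | ENNReal.ofReal lam ≤ D x} := by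
    rintro x ⟨ε, hε, hx⟩
    by_cases hxU : x ∈ ⋃ p ∈ S, Ico (p.1 - 4 * c * p.2) (p.1 + p.2)
    · exact Or.inl hxU
    right
    have hxp : ∀ p ∈ S, x ∉ Ico (p.1 - 4 * c * p.2) (p.1 + p.2) := fun p hp h =>
      hxU (mem_iUnion₂.2 ⟨p, hp, h⟩)
    -- by disjointness the truncation cuts at most one of the intervals
    have hone : ∑ p ∈ S, (Ico p.1 (p.1 + p.2)).indicator
        (fun _ => ENNReal.ofReal (4 * B * lam)) (x + ε) ≤ ENNReal.ofReal (4 * B * lam) := by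
      rw [← Finset.indicator_biUnion_apply S (fun p : ℝ × ℝ => Ico p.1 (p.1 + p.2)) hdisj]
      exact indicator_le_self _ _ _
    have h1 : ENNReal.ofReal ((4 * B + 1) * lam) ≤ D x + ENNReal.ofReal (4 * B * lam) := by
      calc ENNReal.ofReal ((4 * B + 1) * lam)
          ≤ ‖truncated κ ε (fun y => ∑ p ∈ S, b p y) x‖ₑ := by
            rw [Real.enorm_eq_ofReal_abs]
            exact ENNReal.ofReal_le_ofReal hx.le
        _ ≤ ∑ p ∈ S, ‖truncated κ ε (b p) x‖ₑ := by
            rw [hκ.truncated_sum S hb]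
            exact enorm_sum_le _ _
        _ ≤ ∑ p ∈ S, ((Iio (p.1 - 4 * c * p.2)).indicator (oscillation κ (b p) p) x
            + (Ico p.1 (p.1 + p.2)).indicator (fun _ => ENNReal.ofReal (4 * B * lam)) (x + ε)) :=
            Finset.sum_le_sum fun p hp => hκ.enorm_truncated_le_oscillation hc (hb p hp)
              (hpos p hp) (hsupp p hp) (hmean p hp) (hsize p hp) hε (hxp p hp)
        _ ≤ _ := by
            rw [Finset.sum_add_distrib]
            exact add_le_add_right hone _
    rw [show (4 * B + 1) * lam = lam + 4 * B * lam by ring,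
      ENNReal.ofReal_add hlam.le (by positivity)] at h1
    exact (ENNReal.add_le_add_iff_right ENNReal.ofReal_ne_top).1 h1
  have hfirst : volume (⋃ p ∈ S, Ico (p.1 - 4 * c * p.2) (p.1 + p.2))
      ≤ ENNReal.ofReal (4 * c + 1) * ∑ p ∈ S, ENNReal.ofReal p.2 := by
    refine (measure_biUnion_finset_le _ _).trans ?_
    rw [Finset.mul_sum]
    refine Finset.sum_le_sum fun p _ => ?_
    rw [Real.volume_Ico, ← ENNReal.ofReal_mul (by linarith)]
    exact ENNReal.ofReal_le_ofReal (by linarith)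
  have hsecond : volume {x | ENNReal.ofReal lam ≤ D x}
      ≤ ENNReal.ofReal (4 * B) * ∑ p ∈ S, ENNReal.ofReal p.2 := by
    have h0 : ENNReal.ofReal lam ≠ 0 := (ENNReal.ofReal_pos.2 hlam).ne'
    refine (meas_ge_le_lintegral_div (Finset.aemeasurable_fun_sum _ hDm) h0
      ENNReal.ofReal_ne_top).trans ?_
    refine ENNReal.div_le_of_le_mul ?_
    rw [lintegral_finsetSum' _ hDm, mul_assoc, Finset.sum_mul, Finset.mul_sum]
    refine Finset.sum_le_sum fun p hp => ?_
    rw [lintegral_indicator measurableSet_Iio]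
    refine (hκ.lintegral_oscillation_le hc (hb p hp).aestronglyMeasurable p (hpos p hp)).trans ?_
    refine (mul_le_mul_right (hsize p hp) _).trans (le_of_eq ?_)
    have := (hpos p hp).le
    rw [← ENNReal.ofReal_mul hB, ← ENNReal.ofReal_mul this, ← ENNReal.ofReal_mul (by positivity)]
    congr 1
    ring
  refine (measure_mono cover).trans ((measure_union_le _ _).trans ?_)
  rw [ENNReal.ofReal_add (by linarith) (by linarith), add_mul]
  exact add_le_add hfirst hsecond

end IsTruncatedKernel

/-! ### The weak type inequality for truncated kernels -/

/-- The Calderón-Zygmund decomposition of a continuous compactly supported function `f` at height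
`lam`: a bounded function plus finitely many functions with mean zero on disjoint intervals. -/
theorem exists_calderonZygmund_decomposition {f : ℝ → ℝ} (hf : Continuous f)
    (hfc : HasCompactSupport f) {lam : ℝ} (hlam : 0 < lam) :
    ∃ (S : Finset (ℝ × ℝ)) (g : ℝ → ℝ) (b : ℝ × ℝ → ℝ → ℝ),
      (∀ y, f y = g y + ∑ p ∈ S, b p y) ∧
      ((S : Set (ℝ × ℝ)).PairwiseDisjoint fun p => Ico p.1 (p.1 + p.2)) ∧
      (∀ p ∈ S, 0 < p.2) ∧ (∀ p ∈ S, Integrable (b p)) ∧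
      (∀ p ∈ S, ∀ y, y ∉ Ico p.1 (p.1 + p.2) → b p y = 0) ∧
      (∀ p ∈ S, ∫ y, b p y = 0) ∧
      (∀ p ∈ S, ∫⁻ y in Ico p.1 (p.1 + p.2), ‖b p y‖ₑ ≤ ENNReal.ofReal (4 * lam * p.2)) ∧
      Integrable g ∧ (∀ y, |g y| ≤ 2 * lam) ∧ ∫⁻ y, ‖g y‖ₑ ≤ 3 * ∫⁻ y, ‖f y‖ₑ ∧
      ENNReal.ofReal lam * ∑ p ∈ S, ENNReal.ofReal p.2 ≤ ∫⁻ y, ‖f y‖ₑ := by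
  obtain ⟨S, hdisj, hS, hoff⟩ := exists_calderonZygmund_intervals hf hfc hlam
  have hfi : Integrable f := hf.integrable_of_hasCompactSupport hfc
  set m : ℝ × ℝ → ℝ := fun p => p.2⁻¹ * ∫ y in Ico p.1 (p.1 + p.2), f y with hm
  set b : ℝ × ℝ → ℝ → ℝ := fun p => (Ico p.1 (p.1 + p.2)).indicator fun y => f y - m p with hbdef
  have hci : ∀ p : ℝ × ℝ, IntegrableOn (fun y => f y - m p) (Ico p.1 (p.1 + p.2)) := fun p =>
    hfi.integrableOn.sub (integrableOn_const measure_Ico_lt_top.ne)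
  have hbi : ∀ p, Integrable (b p) := fun p =>
    (integrable_indicator_iff measurableSet_Ico).2 (hci p)
  have hvol : ∀ p ∈ S, volume (Ico p.1 (p.1 + p.2)) = ENNReal.ofReal p.2 := fun p _ => by
    rw [Real.volume_Ico, add_sub_cancel_left]
  have hmp : ∀ p ∈ S, p.2 * m p = ∫ y in Ico p.1 (p.1 + p.2), f y := fun p hp => by
    rw [hm]
    simp only
    rw [mul_inv_cancel_left₀ (hS p hp).1.ne']
  have hmle : ∀ p ∈ S, ‖m p‖ₑ * ENNReal.ofReal p.2 ≤ ∫⁻ y in Ico p.1 (p.1 + p.2), ‖f y‖ₑ := by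
    intro p hp
    have : ‖m p‖ₑ * ENNReal.ofReal p.2 = ‖p.2 * m p‖ₑ := by
      rw [enorm_mul p.2, mul_comm, Real.enorm_eq_ofReal (hS p hp).1.le]
    rw [this, hmp p hp]
    exact enorm_integral_le_lintegral_enorm _
  have hb1 : ∀ p ∈ S, ∫⁻ y in Ico p.1 (p.1 + p.2), ‖b p y‖ₑ
      ≤ 2 * ∫⁻ y in Ico p.1 (p.1 + p.2), ‖f y‖ₑ := by
    intro p hp
    calc ∫⁻ y in Ico p.1 (p.1 + p.2), ‖b p y‖ₑ
        ≤ ∫⁻ y in Ico p.1 (p.1 + p.2), (‖f y‖ₑ + ‖m p‖ₑ) := by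
          refine setLIntegral_mono' measurableSet_Ico fun y hy => ?_
          rw [hbdef]
          simp only [indicator_of_mem hy]
          exact enorm_sub_le
      _ = (∫⁻ y in Ico p.1 (p.1 + p.2), ‖f y‖ₑ) + ‖m p‖ₑ * ENNReal.ofReal p.2 := by
          rw [lintegral_add_right _ measurable_const, setLIntegral_const, hvol p hp]
      _ ≤ _ := by
          rw [two_mul]
          exact add_le_add_right (hmle p hp) _
  have hsumf : ∑ p ∈ S, ∫⁻ y in Ico p.1 (p.1 + p.2), ‖f y‖ₑ ≤ ∫⁻ y, ‖f y‖ₑ := by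
    rw [← lintegral_biUnion_finset hdisj (fun _ _ => measurableSet_Ico)]
    exact setLIntegral_le_lintegral _ _
  have hsum : ∀ p ∈ S, ∀ y ∈ Ico p.1 (p.1 + p.2), ∑ p' ∈ S, b p' y = f y - m p := by
    intro p hp y hy
    rw [Finset.sum_eq_single_of_mem p hp]
    · simp [hbdef, hy]
    · intro p' hp' hne
      refine indicator_of_notMem (fun hy' => ?_) _
      exact Set.disjoint_left.1 (hdisj hp' hp hne) hy' hy
  refine ⟨S, fun y => f y - ∑ p ∈ S, b p y, b, fun y => by ring, hdisj, fun p hp => (hS p hp).1,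
    fun p _ => hbi p, fun p _ y hy => indicator_of_notMem hy _, fun p hp => ?_, fun p hp => ?_,
    hfi.sub (integrable_finsetSum _ fun p _ => hbi p), fun y => ?_, ?_, ?_⟩
  · rw [hbdef]
    simp only
    rw [integral_indicator measurableSet_Ico,
      integral_sub hfi.integrableOn (integrableOn_const measure_Ico_lt_top.ne), ← hmp p hp]
    simp [Measure.real, hvol p hp, (hS p hp).1.le]
  · refine (hb1 p hp).trans ((mul_le_mul_right (hS p hp).2.2 _).trans (le_of_eq ?_))
    rw [← ENNReal.ofReal_ofNat, ← ENNReal.ofReal_mul (by norm_num)]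
    congr 1
    ring
  · beta_reduce
    by_cases hy : ∃ p ∈ S, y ∈ Ico p.1 (p.1 + p.2)
    · obtain ⟨p, hp, hyp⟩ := hy
      rw [hsum p hp y hyp, sub_sub_cancel]
      have h1 := (hmle p hp).trans (hS p hp).2.2
      have hpos := (hS p hp).1
      rw [Real.enorm_eq_ofReal_abs, ← ENNReal.ofReal_mul (abs_nonneg _),
        ENNReal.ofReal_le_ofReal_iff (by positivity)] at h1
      exact le_of_mul_le_mul_right h1 hpos
    · push Not at hy
      rw [Finset.sum_eq_zero fun p hp => indicator_of_notMem (hy p hp) _, sub_zero]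
      exact hoff y hy
  · calc ∫⁻ y, ‖f y - ∑ p ∈ S, b p y‖ₑ ≤ ∫⁻ y, (‖f y‖ₑ + ∑ p ∈ S, ‖b p y‖ₑ) :=
          lintegral_mono fun y => enorm_sub_le.trans (add_le_add_right (enorm_sum_le _ _) _)
      _ = (∫⁻ y, ‖f y‖ₑ) + ∑ p ∈ S, ∫⁻ y, ‖b p y‖ₑ := by
          rw [lintegral_add_left' hfi.aestronglyMeasurable.enorm,
            lintegral_finsetSum' _ fun p _ => (hbi p).aestronglyMeasurable.enorm]
      _ ≤ (∫⁻ y, ‖f y‖ₑ) + ∑ p ∈ S, 2 * ∫⁻ y in Ico p.1 (p.1 + p.2), ‖f y‖ₑ := by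
          refine add_le_add_right (Finset.sum_le_sum fun p hp => ?_) _
          refine le_trans (le_of_eq ?_) (hb1 p hp)
          rw [← lintegral_indicator measurableSet_Ico]
          refine lintegral_congr fun y => ?_
          by_cases hy : y ∈ Ico p.1 (p.1 + p.2) <;> simp [hbdef, hy]
      _ ≤ (∫⁻ y, ‖f y‖ₑ) + 2 * ∫⁻ y, ‖f y‖ₑ := by
          rw [← Finset.mul_sum]
          gcongr
      _ = _ := by ring
  · refine le_trans ?_ hsumf
    rw [Finset.mul_sum]
    refine Finset.sum_le_sum fun p hp => ?_
    rw [← ENNReal.ofReal_mul hlam.le]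
    exact (hS p hp).2.1.le

/-- The constant in the weak type `(1, 1)` inequality. -/
noncomputable def weakTypeConst (c B : ℝ) : ℝ :=
  (3 * (1 + 2 * B + 32 * c * (B * (2 + 20 * c)) ^ 2) + (4 * B + 1)) *
    (60 * (B * (2 + 20 * c)) ^ 2 + (4 * c + 1 + 4 * B))

theorem weakTypeConst_pos {c B : ℝ} (hc : 1 ≤ c) (hB : 0 ≤ B) : 0 < weakTypeConst c B := by
  unfold weakTypeConst
  positivity

namespace IsTruncatedKernel

variable {c B : ℝ} {κ : ℝ → ℝ}

/-- At height `lam` the good part of the Calderón-Zygmund decomposition is bounded and the bad part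
is a sum of functions with mean zero; each part has its own estimate. -/
theorem volume_maximal_gt_le_of_continuous (hκ : IsTruncatedKernel c B κ) (hc : 1 ≤ c) {f : ℝ → ℝ}
    (hf : Continuous f) (hfc : HasCompactSupport f) {lam : ℝ} (hlam : 0 < lam) :
    volume {x | ∃ ε, 0 < ε ∧ lam < |truncated κ ε f x|}
      ≤ ENNReal.ofReal (weakTypeConst c B / lam) * ∫⁻ y, ‖f y‖ₑ := by
  have hB := hκ.nonneg
  set C := (B * (2 + 20 * c)) ^ 2 with hC
  have hC0 : 0 ≤ C := sq_nonneg _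
  set Λ₀ := 1 + 2 * B + 32 * c * C with hΛ₀
  have hcC : 0 ≤ c * C := by positivity
  have hΛ1 : 1 ≤ Λ₀ := by rw [hΛ₀]; nlinarith
  -- the height of the decomposition
  set t := lam / (3 * Λ₀ + (4 * B + 1)) with ht
  have hden : 0 < 3 * Λ₀ + (4 * B + 1) := by positivity
  have ht0 : 0 < t := by positivity
  have hlt : lam = 3 * (Λ₀ * t) + (4 * B + 1) * t := by rw [ht]; field_simp
  obtain ⟨S, g, b, hfgb, hdisj, hpos, hbi, hsupp, hmean, hsize, hgi, hgL, hg1, hS⟩ :=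
    exists_calderonZygmund_decomposition hf hfc ht0
  have hgood := hκ.volume_maximal_gt_le_of_bounded hc hgi hgL (Λ := Λ₀ * t) (by positivity)
    (by rw [hΛ₀]; nlinarith [mul_nonneg hcC ht0.le]) (by
      rw [← hC]
      have : 8 * c * C * (2 * t) ^ 2 = 32 * c * C * t ^ 2 := by ring
      rw [this, mul_pow]
      refine mul_le_mul_of_nonneg_right ?_ (sq_nonneg _)
      have : 32 * c * C ≤ Λ₀ := by rw [hΛ₀]; linarith
      nlinarith)
  have hbad := hκ.volume_maximal_sum_gt_le hc ht0 S hdisj hpos hbi hsupp hmean hsize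
  have cover : {x | ∃ ε, 0 < ε ∧ lam < |truncated κ ε f x|}
      ⊆ {x | ∃ ε, 0 < ε ∧ 3 * (Λ₀ * t) < |truncated κ ε g x|} ∪
        {x | ∃ ε, 0 < ε ∧ (4 * B + 1) * t < |truncated κ ε (fun y => ∑ p ∈ S, b p y) x|} := by
    rintro x ⟨ε, hε, hx⟩
    have hadd : truncated κ ε f x
        = truncated κ ε g x + truncated κ ε (fun y => ∑ p ∈ S, b p y) x := by
      simp only [truncated]
      rw [← integral_add (hκ.integrable_mul hgi x).integrableOn
        (hκ.integrable_mul (integrable_finsetSum _ hbi) x).integrableOn]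
      refine integral_congr_ae (Eventually.of_forall fun y => ?_)
      simp only [hfgb y]
      ring
    rcases lt_or_ge (3 * (Λ₀ * t)) |truncated κ ε g x| with h | h
    · exact Or.inl ⟨ε, hε, h⟩
    · refine Or.inr ⟨ε, hε, ?_⟩
      have := abs_add_le (truncated κ ε g x) (truncated κ ε (fun y => ∑ p ∈ S, b p y) x)
      rw [← hadd] at this
      linarith
  have hS' : ∑ p ∈ S, ENNReal.ofReal p.2 ≤ ENNReal.ofReal (1 / t) * ∫⁻ y, ‖f y‖ₑ := by
    have h1 := mul_le_mul_right hS (ENNReal.ofReal (1 / t))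
    rwa [← mul_assoc, ← ENNReal.ofReal_mul (by positivity), one_div_mul_cancel ht0.ne',
      ENNReal.ofReal_one, one_mul] at h1
  have hfirst : ENNReal.ofReal (10 * (B * (2 + 20 * c)) ^ 2 * (2 * t) / (Λ₀ * t) ^ 2) *
      ∫⁻ y, ‖g y‖ₑ ≤ ENNReal.ofReal (60 * C / t) * ∫⁻ y, ‖f y‖ₑ := by
    refine (mul_le_mul_right hg1 _).trans ?_
    rw [← mul_assoc]
    gcongr
    rw [← ENNReal.ofReal_ofNat, ← ENNReal.ofReal_mul (by positivity)]
    apply ENNReal.ofReal_le_ofReal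
    rw [← hC]
    have : 10 * C * (2 * t) / (Λ₀ * t) ^ 2 * 3 = 60 * C / t / Λ₀ ^ 2 := by
      field_simp; ring
    rw [this]
    exact div_le_self (by positivity) (one_le_pow₀ hΛ1)
  refine (measure_mono cover).trans ((measure_union_le _ _).trans
    ((add_le_add (hgood.trans hfirst) (hbad.trans (mul_le_mul_right hS' _))).trans (le_of_eq ?_)))
  rw [← mul_assoc, ← ENNReal.ofReal_mul (by positivity), ← add_mul,
    ← ENNReal.ofReal_add (by positivity) (by positivity)]
  congr 2
  rw [weakTypeConst, ← hC, ← hΛ₀, ht]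
  field_simp

/-- The weak type `(1, 1)` inequality for the maximal truncation. Passing from continuous to
integrable functions is immediate, because the kernel is bounded. -/
theorem volume_maximal_gt_le (hκ : IsTruncatedKernel c B κ) (hc : 1 ≤ c) {f : ℝ → ℝ}
    (hf : Integrable f) {lam : ℝ} (hlam : 0 < lam) :
    volume {x | ∃ ε, 0 < ε ∧ lam < |truncated κ ε f x|}
      ≤ ENNReal.ofReal (2 * weakTypeConst c B / lam) * ∫⁻ y, ‖f y‖ₑ := by
  obtain ⟨M, hM⟩ := hκ.bounded
  have hM0 : 0 ≤ M := (abs_nonneg _).trans (hM 0)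
  have step : ∀ η : ℝ, 0 < η → volume {x | ∃ ε, 0 < ε ∧ lam < |truncated κ ε f x|}
      ≤ ENNReal.ofReal (2 * weakTypeConst c B / lam) * ((∫⁻ y, ‖f y‖ₑ) + ENNReal.ofReal η) := by
    intro η hη
    set η' := min η (lam / (2 * (M + 1))) with hη'
    have hη'0 : 0 < η' := by positivity
    obtain ⟨g, hgc, hfg, hg, hgi⟩ := hf.exists_hasCompactSupport_lintegral_sub_le
      (ε := ENNReal.ofReal η') (by simpa using hη'0)
    have cover : {x | ∃ ε, 0 < ε ∧ lam < |truncated κ ε f x|}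
        ⊆ {x | ∃ ε, 0 < ε ∧ lam / 2 < |truncated κ ε g x|} := by
      rintro x ⟨ε, hε, hx⟩
      refine ⟨ε, hε, ?_⟩
      have hd : |truncated κ ε f x - truncated κ ε g x| ≤ M * η' := by
        rw [truncated, truncated, ← integral_sub (hκ.integrable_mul hf x).integrableOn
          (hκ.integrable_mul hgi x).integrableOn, ← Real.norm_eq_abs,
          ← ENNReal.ofReal_le_ofReal_iff (by positivity), ofReal_norm]
        refine (enorm_integral_le_lintegral_enorm _).trans ?_
        calc ∫⁻ y in Ioi (x + ε), ‖κ (x - y) * f y - κ (x - y) * g y‖ₑ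
            ≤ ∫⁻ y, ‖κ (x - y) * f y - κ (x - y) * g y‖ₑ := setLIntegral_le_lintegral _ _
          _ ≤ ∫⁻ y, ENNReal.ofReal M * ‖f y - g y‖ₑ := by
              refine lintegral_mono fun y => ?_
              rw [← mul_sub, enorm_mul, Real.enorm_eq_ofReal_abs (κ _)]
              gcongr
              exact hM _
          _ = ENNReal.ofReal M * ∫⁻ y, ‖f y - g y‖ₑ :=
              lintegral_const_mul' _ _ ENNReal.ofReal_ne_top
          _ ≤ _ := by
              rw [ENNReal.ofReal_mul hM0]
              gcongr
      have h1 : M * η' ≤ lam / 2 := by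
        have h2 : M * η' ≤ M * (lam / (2 * (M + 1))) :=
          mul_le_mul_of_nonneg_left (min_le_right _ _) hM0
        have h3 : M * (lam / (2 * (M + 1))) = lam / 2 * (M / (M + 1)) := by field_simp
        have h4 : M / (M + 1) ≤ 1 := by rw [div_le_one (by linarith)]; linarith
        rw [h3] at h2
        nlinarith
      have h5 := abs_sub_abs_le_abs_sub (truncated κ ε f x) (truncated κ ε g x)
      linarith
    refine (measure_mono cover).trans
      ((hκ.volume_maximal_gt_le_of_continuous hc hg hgc (half_pos hlam)).trans ?_)
    rw [show weakTypeConst c B / (lam / 2) = 2 * weakTypeConst c B / lam by field_simp]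
    gcongr
    calc ∫⁻ y, ‖g y‖ₑ ≤ ∫⁻ y, (‖f y‖ₑ + ‖f y - g y‖ₑ) := by
          refine lintegral_mono fun y => ?_
          have : g y = f y - (f y - g y) := by ring
          calc ‖g y‖ₑ = ‖f y - (f y - g y)‖ₑ := by rw [← this]
            _ ≤ _ := enorm_sub_le
      _ = (∫⁻ y, ‖f y‖ₑ) + ∫⁻ y, ‖f y - g y‖ₑ :=
          lintegral_add_left' hf.aestronglyMeasurable.enorm _
      _ ≤ _ := by
          gcongr
          exact hfg.trans (ENNReal.ofReal_le_ofReal (min_le_left _ _))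
  refine ge_of_tendsto (x := 𝓝[>] (0 : ℝ)) ?_ (eventually_mem_nhdsWithin.mono step)
  refine ENNReal.Tendsto.const_mul ?_ (Or.inr ENNReal.ofReal_ne_top)
  have h1 : Tendsto (fun η : ℝ => ENNReal.ofReal η) (𝓝[>] 0) (𝓝 0) := by
    have := (ENNReal.continuous_ofReal.tendsto (0 : ℝ)).mono_left (nhdsWithin_le_nhds (s := Ioi 0))
    rwa [ENNReal.ofReal_zero] at this
  simpa using h1.const_add (∫⁻ y, ‖f y‖ₑ)

end IsTruncatedKernel

/-! ### Young functions, the Hörmander condition, and the weak type inequality -/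

namespace IsYoung

variable {A : ℝ≥0 → ℝ≥0}

theorem le_mul (hA : IsYoung A) {θ t : ℝ≥0} (hθ : θ ≤ 1) : A (θ * t) ≤ θ * A t := by
  have h := hA.convex.2 (mem_univ t) (mem_univ 0) (zero_le (a := θ)) (zero_le (a := 1 - θ))
    (add_tsub_cancel_of_le hθ)
  simpa [hA.map_zero] using h

theorem monotone (hA : IsYoung A) : Monotone A := by
  intro s t hst
  rcases eq_or_ne t 0 with rfl | ht
  · rw [le_antisymm hst zero_le]
  · have h1 : s / t ≤ 1 := div_le_one_of_le₀ hst zero_le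
    have h2 := hA.le_mul (t := t) h1
    rw [div_mul_cancel₀ _ ht] at h2
    exact h2.trans (mul_le_of_le_one_left zero_le h1)

theorem le_one_add (hA : IsYoung A) (t : ℝ≥0) : t ≤ 1 + A t := by
  rcases le_or_gt t 1 with h | h
  · exact h.trans (le_add_of_nonneg_right zero_le)
  · have ht : t ≠ 0 := (zero_lt_one.trans h).ne'
    have h1 := hA.le_mul (θ := t⁻¹) (t := t) (inv_le_one_of_one_le₀ h.le)
    rw [inv_mul_cancel₀ ht, hA.map_one] at h1
    have h2 : t ≤ A t := by
      have := mul_le_mul_right h1 t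
      rwa [mul_one, mul_inv_cancel_left₀ ht] at this
    exact h2.trans (le_add_of_nonneg_left zero_le)

end IsYoung

theorem mul_le_add_complementary (A : ℝ≥0 → ℝ≥0) (s t : ℝ≥0) :
    (s : ℝ≥0∞) * t ≤ A t + complementary A s :=
  tsub_le_iff_left.1 (le_iSup (fun t : ℝ≥0 => (s : ℝ≥0∞) * t - A t) t)

/-- Hölder's inequality for the complementary pair, in terms of a number `μ` that bounds the
Luxemburg average of one of the functions. -/
theorem lintegral_mul_le_luxemburg {A : ℝ≥0 → ℝ≥0} (hA : IsYoung A) {E : Set ℝ}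
    (hE0 : volume E ≠ 0) (hE : volume E ≠ ∞) {f g : ℝ → ℝ} (hf : AEStronglyMeasurable f volume)
    {μ : ℝ≥0} (hμ : 0 < μ) (hfμ : ∫⁻ y in E, (A (‖f y‖₊ / μ) : ℝ≥0∞) ≤ volume E) :
    ∫⁻ y in E, ‖g y‖ₑ * ‖f y‖ₑ ≤ 2 * volume E * μ * luxemburg (complementary A) E g := by
  have hc0 : 2 * volume E * μ ≠ 0 := by
    simp [hE0, hμ.ne']
  have hc : 2 * volume E * μ ≠ ∞ := by finiteness
  rw [mul_comm, ← ENNReal.div_le_iff hc0 hc]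
  refine le_iInf fun r => le_iInf fun hr => le_iInf fun hgr => ?_
  rw [ENNReal.div_le_iff hc0 hc]
  have hgr' : ∫⁻ y in E, complementary A (‖g y‖₊ / r) ≤ volume E := by
    have h1 := mul_le_mul_right hgr (volume E)
    rwa [← mul_assoc, ENNReal.mul_inv_cancel hE0 hE, one_mul, mul_one] at h1
  calc ∫⁻ y in E, ‖g y‖ₑ * ‖f y‖ₑ
      ≤ ∫⁻ y in E, ((r * μ : ℝ≥0) : ℝ≥0∞) *
          ((A (‖f y‖₊ / μ) : ℝ≥0∞) + complementary A (‖g y‖₊ / r)) := by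
        refine lintegral_mono fun y => ?_
        refine le_trans (le_of_eq ?_) (mul_le_mul_right (mul_le_add_complementary A _ _) _)
        rw [enorm_eq_nnnorm, enorm_eq_nnnorm]
        norm_cast
        field_simp
    _ = ((r * μ : ℝ≥0) : ℝ≥0∞) * ((∫⁻ y in E, (A (‖f y‖₊ / μ) : ℝ≥0∞))
          + ∫⁻ y in E, complementary A (‖g y‖₊ / r)) := by
        rw [lintegral_const_mul' _ _ ENNReal.coe_ne_top, lintegral_add_left']
        exact (hA.monotone.measurable.comp_aemeasurable
          (hf.restrict.nnnorm.aemeasurable.div_const μ)).coe_nnreal_ennreal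
    _ ≤ ((r * μ : ℝ≥0) : ℝ≥0∞) * (volume E + volume E) := by gcongr
    _ = _ := by push_cast; ring

/-- The condition `Hormander Φ K` with explicit constants `c` and `C`. -/
def HormanderWith (Φ : ℝ≥0 → ℝ≥0∞) (K : ℝ → ℝ) (c C : ℝ≥0) : Prop :=
  ∀ x R : ℝ, (c : ℝ) * |x| < R →
    ∑' m : ℕ, ENNReal.ofReal (2 ^ (m + 1) * R) *
      luxemburg Φ (Metric.ball 0 (2 ^ (m + 2) * R))
        ({y : ℝ | 2 ^ (m + 1) * R < |y| ∧ |y| ≤ 2 ^ (m + 2) * R}.indicator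
          fun y => K (x - y) - K (-y)) ≤ (C : ℝ≥0∞)

/-- The Hörmander condition against a weight `f`, whose means are controlled in the sense of `A`. -/
theorem lintegral_hormander_mul_le {A : ℝ≥0 → ℝ≥0} (hA : IsYoung A) {K : ℝ → ℝ} {c C : ℝ≥0}
    (hH : HormanderWith (complementary A) K c C)
    {h R : ℝ} (hR : (c : ℝ) * |h| < R) {f : ℝ → ℝ} (hf : AEStronglyMeasurable f volume) {μ : ℝ≥0}
    (hμ : 0 < μ) (hfμ : ∀ m : ℕ, ∫⁻ y in Metric.ball 0 (2 ^ (m + 2) * R), (A (‖f y‖₊ / μ) : ℝ≥0∞)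
      ≤ volume (Metric.ball (0 : ℝ) (2 ^ (m + 2) * R))) :
    ∫⁻ u in Ioi (2 * R), ‖K (h - u) - K (-u)‖ₑ * ‖f u‖ₑ ≤ 8 * C * μ := by
  have hR0 : 0 < R := lt_of_le_of_lt (by positivity) hR
  have hcover : Ioi (2 * R) ⊆ ⋃ m : ℕ, Ico (2 ^ (m + 1) * R) (2 ^ (m + 2) * R) := by
    intro u hu
    obtain ⟨m, hm1, hm2⟩ := exists_nat_pow_near (x := u / (2 * R)) (y := 2)
      (by rw [one_le_div (by positivity)]; exact le_of_lt hu) (by norm_num)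
    refine mem_iUnion.2 ⟨m, ?_, ?_⟩
    · rw [le_div_iff₀ (by positivity)] at hm1
      calc 2 ^ (m + 1) * R = 2 ^ m * (2 * R) := by ring
        _ ≤ u := hm1
    · rw [div_lt_iff₀ (by positivity)] at hm2
      calc u < 2 ^ (m + 1) * (2 * R) := hm2
        _ = _ := by ring
  calc ∫⁻ u in Ioi (2 * R), ‖K (h - u) - K (-u)‖ₑ * ‖f u‖ₑ
      ≤ ∫⁻ u in ⋃ m : ℕ, Ico (2 ^ (m + 1) * R) (2 ^ (m + 2) * R),
          ‖K (h - u) - K (-u)‖ₑ * ‖f u‖ₑ := lintegral_mono_set hcover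
    _ ≤ ∑' m : ℕ, ∫⁻ u in Ico (2 ^ (m + 1) * R) (2 ^ (m + 2) * R),
          ‖K (h - u) - K (-u)‖ₑ * ‖f u‖ₑ := lintegral_iUnion_le _ _
    _ ≤ ∑' m : ℕ, (8 * μ : ℝ≥0∞) * (ENNReal.ofReal (2 ^ (m + 1) * R) *
        luxemburg (complementary A) (Metric.ball 0 (2 ^ (m + 2) * R))
          ({y : ℝ | 2 ^ (m + 1) * R < |y| ∧ |y| ≤ 2 ^ (m + 2) * R}.indicator
            fun y => K (h - y) - K (-y))) := by
        refine ENNReal.tsum_le_tsum fun m => ?_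
        have hp : 0 < 2 ^ (m + 2) * R := by positivity
        have hp' : 0 < 2 ^ (m + 1) * R := by positivity
        have hvol : volume (Metric.ball (0 : ℝ) (2 ^ (m + 2) * R))
            = 4 * ENNReal.ofReal (2 ^ (m + 1) * R) := by
          rw [Real.volume_ball, ← ENNReal.ofReal_ofNat, ← ENNReal.ofReal_mul (by norm_num)]
          congr 1
          ring
        have hvol0 : volume (Metric.ball (0 : ℝ) (2 ^ (m + 2) * R)) ≠ 0 := by
          rw [Real.volume_ball]
          exact (ENNReal.ofReal_pos.2 (by positivity)).ne'
        have key := lintegral_mul_le_luxemburg hA hvol0 measure_ball_lt_top.ne hf hμ (hfμ m)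
          (g := {y : ℝ | 2 ^ (m + 1) * R < |y| ∧ |y| ≤ 2 ^ (m + 2) * R}.indicator
            fun y => K (h - y) - K (-y))
        rw [hvol] at key
        refine le_trans ?_ (key.trans (le_of_eq (by ring)))
        rw [setLIntegral_congr Ioo_ae_eq_Ico.symm]
        have hsub : Ioo (2 ^ (m + 1) * R) (2 ^ (m + 2) * R)
            ⊆ Metric.ball 0 (2 ^ (m + 2) * R) := by
          intro u hu
          rw [mem_ball_zero_iff, Real.norm_eq_abs, abs_of_pos (hp'.trans hu.1)]
          exact hu.2
        refine le_trans (le_of_eq ?_) (lintegral_mono_set hsub)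
        refine setLIntegral_congr_fun measurableSet_Ioo fun u hu => ?_
        have : u ∈ {y : ℝ | 2 ^ (m + 1) * R < |y| ∧ |y| ≤ 2 ^ (m + 2) * R} := by
          rw [mem_ofPred_eq, abs_of_pos (hp'.trans hu.1)]
          exact ⟨hu.1, hu.2.le⟩
        simp only [indicator_of_mem this]
    _ ≤ 8 * μ * C := by
        rw [ENNReal.tsum_mul_left]
        gcongr
        exact hH h R hR
    _ = _ := by ring

namespace IsSingularKernel

variable {K : ℝ → ℝ}

theorem aesm (hK : IsSingularKernel K) : AEStronglyMeasurable K volume := by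
  have h := hK.locallyIntegrable.aestronglyMeasurable
  rwa [Measure.restrict_eq_self_of_ae_mem] at h
  rw [ae_iff]
  simp

theorem integral_annulus (hK : IsSingularKernel K) {ε N : ℝ} (hε : 0 < ε) :
    ∫ x in {x : ℝ | ε < |x| ∧ |x| < N}, K x = ∫ x in Ioo (-N) (-ε), K x := by
  refine setIntegral_eq_of_subset_of_forall_sdiff_eq_zero ?_ ?_ ?_
  · exact (measurableSet_lt measurable_const measurable_norm).inter
      (measurableSet_lt measurable_norm measurable_const)
  · intro x hx
    have : |x| = -x := abs_of_neg (by linarith [hx.2])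
    rw [mem_ofPred_eq, this]
    exact ⟨by linarith [hx.2], by linarith [hx.1]⟩
  · rintro x ⟨⟨h1, h2⟩, h3⟩
    refine hK.support x ?_
    by_contra hx
    have : |x| = -x := abs_of_nonpos (not_lt.1 hx)
    exact h3 ⟨by linarith, by linarith⟩

/-- All truncations of the kernel satisfy the same estimates. For the Hörmander condition, the
jumps that the truncation introduces are absorbed by the size condition. -/
theorem exists_isTruncatedKernel (hK : IsSingularKernel K) {A : ℝ≥0 → ℝ≥0} (hA : IsYoung A)
    (hKA : Hormander (complementary A) K) :
    ∃ c B : ℝ, 1 ≤ c ∧ ∀ a b : ℝ, 0 < a → a < b →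
      IsTruncatedKernel c B ((Ioo (-b) (-a)).indicator K) := by
  obtain ⟨c, C, hc, -, hH⟩ := hKA
  obtain ⟨B₁, hB₁⟩ := hK.cancellation
  obtain ⟨B₂, hB₂⟩ := hK.size
  have hB₁0 : 0 ≤ B₁ := (abs_nonneg _).trans (hB₁ 1 2 one_pos one_lt_two)
  have hB₂0 : 0 ≤ B₂ := by simpa using (abs_nonneg _).trans (hB₂ 1 one_ne_zero)
  refine ⟨c, B₁ + 8 * C + 4 * B₂, by exact_mod_cast hc, fun a b ha hab => ?_⟩
  have hc' : (1 : ℝ) ≤ c := by exact_mod_cast hc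
  have hκsize : ∀ x, |(Ioo (-b) (-a)).indicator K x| ≤ B₂ / |x| := by
    intro x
    by_cases hx : x ∈ Ioo (-b) (-a)
    · rw [indicator_of_mem hx]
      exact hB₂ x (by linarith [hx.2] : x < 0).ne
    · rw [indicator_of_notMem hx, abs_zero]
      positivity
  constructor
  · exact hK.aesm.indicator measurableSet_Ioo
  · intro x hx
    exact indicator_of_notMem (fun h => by linarith [h.2]) _
  · intro x
    refine (hκsize x).trans ?_
    gcongr
    have : (0 : ℝ) ≤ C := C.2
    linarith
  · refine ⟨B₂ / a, fun x => ?_⟩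
    by_cases hx : x ∈ Ioo (-b) (-a)
    · refine (hκsize x).trans ?_
      gcongr
      rw [abs_of_neg (by linarith [hx.2])]
      linarith [hx.2]
    · rw [indicator_of_notMem hx, abs_zero]
      positivity
  · exact ⟨b, fun x hx => indicator_of_notMem (fun h => by linarith [h.1]) _⟩
  · intro h R hR
    rcases eq_or_ne h 0 with rfl | hh
    · simp
    have hh0 : 0 < |h| := abs_pos.2 hh
    have hhR : |h| < R := lt_of_le_of_lt (by nlinarith) hR
    set J : Set ℝ := Icc (a - |h|) (a + |h|) ∪ Icc (b - |h|) (b + |h|) with hJ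
    have hJm : MeasurableSet J := measurableSet_Icc.union measurableSet_Icc
    have hL1 := lintegral_hormander_mul_le hA hH hR (f := fun _ => 1) (μ := 1)
      aestronglyMeasurable_const one_pos (fun m => by simp [hA.map_one])
    simp only [enorm_one, mul_one, ENNReal.coe_one] at hL1
    have hpt : ∀ u ∈ Ioi (2 * R),
        ‖(Ioo (-b) (-a)).indicator K (h - u) - (Ioo (-b) (-a)).indicator K (-u)‖ₑ
        ≤ ‖K (h - u) - K (-u)‖ₑ + J.indicator (fun _ => ENNReal.ofReal (B₂ / |h|)) u := by
      intro u hu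
      have hu' : 2 * R < u := hu
      have hle := le_abs_self h
      have hge := neg_abs_le h
      have s1 : ‖(Ioo (-b) (-a)).indicator K (h - u)‖ₑ ≤ ENNReal.ofReal (B₂ / |h|) := by
        rw [Real.enorm_eq_ofReal_abs]
        refine ENNReal.ofReal_le_ofReal ((hκsize _).trans ?_)
        refine div_le_div_of_nonneg_left hB₂0 hh0 ?_
        rw [abs_sub_comm, abs_of_pos (a := u - h) (by linarith)]
        linarith
      have s2 : ‖(Ioo (-b) (-a)).indicator K (-u)‖ₑ ≤ ENNReal.ofReal (B₂ / |h|) := by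
        rw [Real.enorm_eq_ofReal_abs]
        refine ENNReal.ofReal_le_ofReal ((hκsize _).trans ?_)
        refine div_le_div_of_nonneg_left hB₂0 hh0 ?_
        rw [abs_neg, abs_of_pos (a := u) (by linarith)]
        linarith
      by_cases m1 : h - u ∈ Ioo (-b) (-a) <;> by_cases m2 : -u ∈ Ioo (-b) (-a)
      · rw [indicator_of_mem m1, indicator_of_mem m2]
        exact le_add_right le_rfl
      · have huJ : u ∈ J := by
          by_cases hub : u < b
          · left
            have : u ≤ a := by
              by_contra hcon
              exact m2 ⟨by linarith, by linarith⟩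
            exact ⟨by linarith [m1.2], by linarith⟩
          · right
            exact ⟨by linarith, by linarith [m1.1]⟩
        rw [indicator_of_notMem m2, sub_zero, indicator_of_mem huJ]
        exact le_add_left s1
      · have huJ : u ∈ J := by
          by_cases hub : u - h < b
          · left
            have : u - h ≤ a := by
              by_contra hcon
              exact m1 ⟨by linarith, by linarith⟩
            exact ⟨by linarith [m2.2], by linarith⟩
          · right
            exact ⟨by linarith [m2.1], by linarith [m2.1]⟩
        rw [indicator_of_notMem m1, zero_sub, enorm_neg, indicator_of_mem huJ]
        exact le_add_left s2
      · rw [indicator_of_notMem m1, indicator_of_notMem m2, sub_zero, enorm_zero]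
        exact zero_le
    calc ∫⁻ u in Ioi (2 * R),
        ‖(Ioo (-b) (-a)).indicator K (h - u) - (Ioo (-b) (-a)).indicator K (-u)‖ₑ
        ≤ ∫⁻ u in Ioi (2 * R), (‖K (h - u) - K (-u)‖ₑ
            + J.indicator (fun _ => ENNReal.ofReal (B₂ / |h|)) u) :=
          setLIntegral_mono' measurableSet_Ioi hpt
      _ = (∫⁻ u in Ioi (2 * R), ‖K (h - u) - K (-u)‖ₑ)
            + ∫⁻ u in Ioi (2 * R), J.indicator (fun _ => ENNReal.ofReal (B₂ / |h|)) u :=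
          lintegral_add_right _ (measurable_const.indicator hJm)
      _ ≤ ENNReal.ofReal (8 * C) + ENNReal.ofReal (4 * B₂) := by
          refine add_le_add (hL1.trans (le_of_eq ?_)) ?_
          · rw [ENNReal.ofReal_mul (by norm_num), ENNReal.ofReal_coe_nnreal, ENNReal.ofReal_ofNat]
          · refine (setLIntegral_le_lintegral _ _).trans ?_
            rw [lintegral_indicator hJm, setLIntegral_const]
            refine (mul_le_mul_right (measure_union_le _ _) _).trans (le_of_eq ?_)
            rw [Real.volume_Icc, Real.volume_Icc,
              ← ENNReal.ofReal_add (by linarith) (by linarith),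
              ← ENNReal.ofReal_mul (by positivity)]
            congr 1
            field_simp
            ring
      _ ≤ _ := by
          have : (0 : ℝ) ≤ C := C.2
          rw [← ENNReal.ofReal_add (by positivity) (by positivity)]
          exact ENNReal.ofReal_le_ofReal (by linarith)
  · intro s hs
    have : (0 : ℝ) ≤ C := C.2
    rw [setIntegral_indicator measurableSet_Ioo, Ioo_inter_Ioo]
    have h1 : max (-s) (-b) = -(min s b) := by rw [max_neg_neg]
    rw [h1, min_eq_right (by linarith : -a ≤ 0)]
    rcases lt_or_ge a (min s b) with hlt | hge
    · rw [← hK.integral_annulus ha]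
      linarith [hB₁ a (min s b) ha hlt]
    · rw [Ioo_eq_empty (by linarith)]
      simp only [Measure.restrict_empty, integral_zero_measure, abs_zero]
      positivity

theorem integrableOn_mul (hK : IsSingularKernel K) {f : ℝ → ℝ} (hf : Integrable f) (x : ℝ) {ε : ℝ}
    (hε : 0 < ε) : IntegrableOn (fun y => K (x - y) * f y) (Ioi (x + ε)) := by
  obtain ⟨B, hB⟩ := hK.size
  have hB0 : 0 ≤ B := by simpa using (abs_nonneg _).trans (hB 1 one_ne_zero)
  refine hf.integrableOn.bdd_mul (c := B / ε) ?_ ?_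
  · exact (hK.aesm.comp_measurePreserving
      (Measure.measurePreserving_sub_left (volume : Measure ℝ) x)).restrict
  · refine (ae_restrict_mem measurableSet_Ioi).mono fun y hy => ?_
    have hy' : x + ε < y := hy
    rw [Real.norm_eq_abs]
    refine (hB _ (by linarith : x - y < 0).ne).trans ?_
    refine div_le_div_of_nonneg_left hB0 hε ?_
    rw [abs_sub_comm, abs_of_pos (by linarith)]
    linarith

theorem tendsto_truncated_indicator (hK : IsSingularKernel K) {f : ℝ → ℝ} (hf : Integrable f)
    (x : ℝ) {ε : ℝ} (hε : 0 < ε) :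
    Tendsto (fun n : ℕ => truncated
      ((Ioo (-((n : ℝ) + 2)) (-(1 / ((n : ℝ) + 1)))).indicator K) ε f x) atTop
      (𝓝 (truncated K ε f x)) := by
  have hi := hK.integrableOn_mul hf x hε
  refine tendsto_integral_of_dominated_convergence (fun y => ‖K (x - y) * f y‖) (fun n => ?_)
    hi.norm (fun n => ?_) ?_
  · exact ((hK.aesm.indicator measurableSet_Ioo).comp_measurePreserving
      (Measure.measurePreserving_sub_left (volume : Measure ℝ) x)).restrict.mul
      hf.aestronglyMeasurable.restrict
  · refine Eventually.of_forall fun y => ?_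
    rw [norm_mul, norm_mul]
    gcongr
    rw [norm_indicator_eq_indicator_norm]
    exact indicator_le_self' (fun _ _ => norm_nonneg _) _
  · refine (ae_restrict_mem measurableSet_Ioi).mono fun y hy => ?_
    have hy' : x + ε < y := hy
    refine tendsto_const_nhds.congr' ?_
    have e1 := (tendsto_one_div_add_atTop_nhds_zero_nat (𝕜 := ℝ)).eventually_lt_const hε
    filter_upwards [e1, eventually_gt_atTop ⌈y - x⌉₊] with n h1 h2
    have h3 : y - x < n := (Nat.le_ceil _).trans_lt (by exact_mod_cast h2)
    rw [indicator_of_mem]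
    exact ⟨by linarith, by linarith⟩

/-- The weak type `(1, 1)` inequality for the maximal singular integral. -/
theorem exists_volume_maximal_gt_le (hK : IsSingularKernel K) {A : ℝ≥0 → ℝ≥0} (hA : IsYoung A)
    (hKA : Hormander (complementary A) K) :
    ∃ W : ℝ, 0 < W ∧ ∀ f : ℝ → ℝ, Integrable f → ∀ lam : ℝ, 0 < lam →
      volume {x | ∃ ε, 0 < ε ∧ lam < |truncated K ε f x|}
        ≤ ENNReal.ofReal (W / lam) * ∫⁻ y, ‖f y‖ₑ := by
  obtain ⟨c, B, hc, hκ⟩ := hK.exists_isTruncatedKernel hA hKA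
  have hB : 0 ≤ B := (hκ 1 2 one_pos one_lt_two).nonneg
  refine ⟨2 * weakTypeConst c B, by have := weakTypeConst_pos hc hB; positivity,
    fun f hf lam hlam => ?_⟩
  set κ : ℕ → ℝ → ℝ := fun n => (Ioo (-((n : ℝ) + 2)) (-(1 / ((n : ℝ) + 1)))).indicator K
  have hκn : ∀ n, IsTruncatedKernel c B (κ n) := fun n => by
    refine hκ _ _ (by positivity) ?_
    have h1 : 1 / ((n : ℝ) + 1) ≤ 1 := by
      rw [div_le_one (by positivity)]
      linarith [n.cast_nonneg (α := ℝ)]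
    linarith [n.cast_nonneg (α := ℝ)]
  set E : ℕ → Set ℝ := fun n => {x | ∃ ε, 0 < ε ∧ lam < |truncated (κ n) ε f x|} with hE
  have cover : {x | ∃ ε, 0 < ε ∧ lam < |truncated K ε f x|} ⊆ ⋃ N, ⋂ n, ⋂ (_ : N ≤ n), E n := by
    rintro x ⟨ε, hε, hx⟩
    have h1 := (hK.tendsto_truncated_indicator hf x hε).abs.eventually_const_lt hx
    obtain ⟨N, hN⟩ := eventually_atTop.1 h1
    exact mem_iUnion.2 ⟨N, mem_iInter₂.2 fun n hn => ⟨ε, hε, hN n hn⟩⟩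
  have hmono : Monotone fun N => ⋂ n, ⋂ (_ : N ≤ n), E n := by
    intro N N' hN x hx
    simp only [mem_iInter] at hx ⊢
    exact fun n hn => hx n (hN.trans hn)
  refine (measure_mono cover).trans ?_
  rw [hmono.measure_iUnion]
  refine iSup_le fun N => ?_
  refine (measure_mono (fun x hx => mem_iInter₂.1 hx N le_rfl)).trans ?_
  exact (hκn N).volume_maximal_gt_le hc hf hlam

end IsSingularKernel

/-! ### Almost everywhere convergence -/

namespace IsSingularKernel

variable {K : ℝ → ℝ}

/-- For smooth functions the truncations converge everywhere, by the cancellation condition. -/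
theorem exists_tendsto_truncated_of_contDiff (hK : IsSingularKernel K) {g : ℝ → ℝ}
    (hg : ContDiff ℝ (⊤ : ℕ∞) g) (hgc : HasCompactSupport g) (x : ℝ) :
    ∃ l, Tendsto (fun ε => truncated K ε g x) (𝓝[>] 0) (𝓝 l) := by
  obtain ⟨B, hB⟩ := hK.size
  have hB0 : 0 ≤ B := by simpa using (abs_nonneg _).trans (hB 1 one_ne_zero)
  obtain ⟨D, hD⟩ := hg.lipschitzWith_of_hasCompactSupport hgc (by simp)
  obtain ⟨N', hN'⟩ := hgc.isBounded.subset_closedBall 0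
  set N := |N'| + |x| + 1 with hN
  have hN0 : 0 < N := by positivity
  have hout : ∀ y, x + N ≤ y → g y = 0 := by
    intro y hy
    by_contra hne
    have h1 := hN' (subset_tsupport g hne)
    rw [mem_closedBall_zero_iff, Real.norm_eq_abs] at h1
    linarith [le_abs_self y, neg_abs_le x, le_abs_self N']
  obtain ⟨l, hl⟩ := hK.limit N hN0
  have hKx : AEStronglyMeasurable (fun y => K (x - y)) volume := hK.aesm.comp_measurePreserving
    (Measure.measurePreserving_sub_left (volume : Measure ℝ) x)
  set φ : ℝ → ℝ := fun y => K (x - y) * (g y - g x) with hφ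
  have hφm : AEStronglyMeasurable φ volume :=
    hKx.mul (hg.continuous.sub continuous_const).aestronglyMeasurable
  have hφb : ∀ y, x < y → ‖φ y‖ ≤ B * D := by
    intro y hy
    have h1 : 0 < |x - y| := abs_pos.2 (by linarith)
    have h2 := hD.dist_le_mul y x
    rw [Real.dist_eq, Real.dist_eq, abs_sub_comm y x] at h2
    rw [hφ, norm_mul, Real.norm_eq_abs, Real.norm_eq_abs]
    calc |K (x - y)| * |g y - g x| ≤ (B / |x - y|) * (D * |x - y|) := by
          gcongr
          exact hB _ (by linarith : x - y < 0).ne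
      _ = B * D := by field_simp
  refine ⟨g x * l + ∫ y in Ioo x (x + N), φ y, ?_⟩
  have hsecond : Tendsto (fun ε : ℝ => ∫ y in Ioo x (x + N), (Ioi (x + ε)).indicator φ y) (𝓝[>] 0)
      (𝓝 (∫ y in Ioo x (x + N), φ y)) := by
    refine tendsto_integral_filter_of_dominated_convergence (fun _ => B * D) ?_ ?_ ?_ ?_
    · exact Eventually.of_forall fun ε => (hφm.indicator measurableSet_Ioi).restrict
    · refine Eventually.of_forall fun ε => (ae_restrict_mem measurableSet_Ioo).mono fun y hy => ?_
      rw [norm_indicator_eq_indicator_norm]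
      exact (indicator_le_self' (fun _ _ => norm_nonneg _) _).trans (hφb y hy.1)
    · exact integrableOn_const measure_Ioo_lt_top.ne
    · refine (ae_restrict_mem measurableSet_Ioo).mono fun y hy => tendsto_const_nhds.congr' ?_
      filter_upwards [Ioo_mem_nhdsGT (show (0 : ℝ) < y - x by linarith [hy.1])] with ε hε
      rw [indicator_of_mem]
      simp only [mem_Ioi]
      linarith [hε.2]
  refine Tendsto.congr' ?_ ((hl.const_mul (g x)).add hsecond)
  filter_upwards [Ioo_mem_nhdsGT hN0] with ε hε
  have hKi : IntegrableOn (fun y => K (x - y)) (Ioo (x + ε) (x + N)) := by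
    refine Measure.integrableOn_of_bounded (M := B / ε) measure_Ioo_lt_top.ne hKx ?_
    refine (ae_restrict_mem measurableSet_Ioo).mono fun y hy => ?_
    rw [Real.norm_eq_abs]
    refine (hB _ (by linarith [hy.1, hε.1] : x - y < 0).ne).trans ?_
    refine div_le_div_of_nonneg_left hB0 hε.1 ?_
    rw [abs_sub_comm, abs_of_pos (by linarith [hy.1, hε.1])]
    linarith [hy.1]
  have hφi : IntegrableOn φ (Ioo (x + ε) (x + N)) := by
    refine Measure.integrableOn_of_bounded (M := B * D) measure_Ioo_lt_top.ne hφm ?_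
    exact (ae_restrict_mem measurableSet_Ioo).mono fun y hy => hφb y (by linarith [hy.1, hε.1])
  have e1 : ∫ s in {s : ℝ | ε < |s| ∧ |s| < N}, K s = ∫ y in Ioo (x + ε) (x + N), K (x - y) := by
    rw [hK.integral_annulus hε.1]
    have hmp := Measure.measurePreserving_sub_left (volume : Measure ℝ) x
    rw [← hmp.setIntegral_preimage_emb (Homeomorph.subLeft x).measurableEmbedding]
    congr 2
    ext y
    simp only [mem_preimage, mem_Ioo]
    constructor <;> rintro ⟨h1, h2⟩ <;> constructor <;> linarith
  have e2 : ∫ y in Ioo x (x + N), (Ioi (x + ε)).indicator φ y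
      = ∫ y in Ioo (x + ε) (x + N), φ y := by
    rw [setIntegral_indicator measurableSet_Ioi]
    congr 2
    ext y
    simp only [mem_inter_iff, mem_Ioo, mem_Ioi]
    constructor
    · rintro ⟨⟨h1, h2⟩, h3⟩
      exact ⟨h3, h2⟩
    · rintro ⟨h1, h2⟩
      exact ⟨⟨by linarith [hε.1], h2⟩, h1⟩
  have e3 : truncated K ε g x = ∫ y in Ioo (x + ε) (x + N), K (x - y) * g y := by
    refine setIntegral_eq_of_subset_of_forall_sdiff_eq_zero measurableSet_Ioi Ioo_subset_Ioi_self
      fun y hy => ?_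
    rw [hout y, mul_zero]
    by_contra h
    exact hy.2 ⟨hy.1, not_le.1 h⟩
  rw [e1, e2, e3, ← integral_const_mul, ← integral_add (hKi.const_mul _) hφi]
  refine integral_congr_ae (Eventually.of_forall fun y => ?_)
  simp only [hφ]
  ring

/-- Almost everywhere convergence for integrable functions: the weak type inequality shows that the
oscillation of the truncations at `0` does not change if a smooth function is subtracted. -/
theorem ae_exists_tendsto_truncated_of_integrable (hK : IsSingularKernel K) {A : ℝ≥0 → ℝ≥0}
    (hA : IsYoung A) (hKA : Hormander (complementary A) K) {f : ℝ → ℝ} (hf : Integrable f) :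
    ∀ᵐ x : ℝ, ∃ l, Tendsto (fun ε => truncated K ε f x) (𝓝[>] 0) (𝓝 l) := by
  obtain ⟨W, hW, hweak⟩ := hK.exists_volume_maximal_gt_le hA hKA
  have key : ∀ lam : ℝ, 0 < lam → ∀ᵐ x : ℝ, ∃ d > 0, ∀ ε ∈ Ioo 0 d, ∀ ε' ∈ Ioo 0 d,
      |truncated K ε f x - truncated K ε' f x| ≤ lam := by
    intro lam hlam
    rw [ae_iff]
    refine le_antisymm ?_ zero_le
    have step : ∀ η : ℝ, 0 < η → volume {x : ℝ | ¬∃ d > 0, ∀ ε ∈ Ioo 0 d, ∀ ε' ∈ Ioo 0 d,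
        |truncated K ε f x - truncated K ε' f x| ≤ lam}
        ≤ ENNReal.ofReal (W / (lam / 4)) * ENNReal.ofReal η := by
      intro η hη
      obtain ⟨g, hgc, hg, hfg⟩ := (memLp_one_iff_integrable.2 hf).exist_eLpNorm_sub_le
        ENNReal.one_ne_top le_rfl hη
      have hgi : Integrable g := hg.continuous.integrable_of_hasCompactSupport hgc
      rw [eLpNorm_one_eq_lintegral_enorm] at hfg
      refine le_trans (measure_mono fun x hx => ?_)
        ((hweak (f - g) (hf.sub hgi) (lam / 4) (by positivity)).trans (mul_le_mul_right hfg _))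
      by_contra hcon
      refine hx ?_
      simp only [mem_ofPred_eq, not_exists, not_and, not_lt] at hcon
      have hdiff : ∀ ε, 0 < ε → |truncated K ε f x - truncated K ε g x| ≤ lam / 4 := by
        intro ε hε
        refine le_trans (le_of_eq ?_) (hcon ε hε)
        simp only [truncated, Pi.sub_apply, mul_sub]
        rw [integral_sub (hK.integrableOn_mul hf x hε) (hK.integrableOn_mul hgi x hε)]
      obtain ⟨l, hl⟩ := hK.exists_tendsto_truncated_of_contDiff hg hgc x
      obtain ⟨d, hd, hdl⟩ := mem_nhdsGT_iff_exists_Ioo_subset.1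
        (hl (Metric.ball_mem_nhds l (show 0 < lam / 4 by positivity)))
      refine ⟨d, hd, fun ε hε ε' hε' => ?_⟩
      have h1 := hdl hε
      have h2 := hdl hε'
      simp only [mem_preimage, Metric.mem_ball, Real.dist_eq] at h1 h2
      have h3 := hdiff ε hε.1
      have h4 := hdiff ε' hε'.1
      rw [abs_le] at h3 h4 ⊢
      rw [abs_lt] at h1 h2
      constructor <;> linarith [h1.1, h1.2, h2.1, h2.2, h3.1, h3.2, h4.1, h4.2]
    refine ge_of_tendsto (x := 𝓝[>] (0 : ℝ)) ?_ (eventually_mem_nhdsWithin.mono step)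
    have h1 := (ENNReal.continuous_ofReal.tendsto (0 : ℝ)).mono_left
      (nhdsWithin_le_nhds (s := Ioi 0))
    rw [ENNReal.ofReal_zero] at h1
    simpa using ENNReal.Tendsto.const_mul h1 (Or.inr ENNReal.ofReal_ne_top)
  have hall : ∀ᵐ x : ℝ, ∀ n : ℕ, ∃ d > 0, ∀ ε ∈ Ioo 0 d, ∀ ε' ∈ Ioo 0 d,
      |truncated K ε f x - truncated K ε' f x| ≤ 1 / ((n : ℝ) + 1) :=
    ae_all_iff.2 fun n => key _ (by positivity)
  filter_upwards [hall] with x hx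
  have hcauchy : Cauchy (map (fun ε => truncated K ε f x) (𝓝[>] 0)) := by
    rw [Metric.cauchy_iff]
    refine ⟨inferInstance, fun η hη => ?_⟩
    obtain ⟨n, hn⟩ := exists_nat_one_div_lt hη
    obtain ⟨d, hd, hxd⟩ := hx n
    refine ⟨_, image_mem_map (Ioo_mem_nhdsGT hd), ?_⟩
    rintro _ ⟨ε, hε, rfl⟩ _ ⟨ε', hε', rfl⟩
    exact (hxd ε hε ε' hε').trans_lt hn
  exact cauchy_iff_exists_le_nhds.1 hcauchy

/-- The part of a function beyond `b` contributes to every truncation short of `b` a number that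
does not depend on the truncation. -/
theorem truncated_eq_add {f : ℝ → ℝ} (hf : Admissible K f) {a b x ε : ℝ} (hε : 0 < ε)
    (ha : a ≤ x + ε) (hb : x + ε ≤ b) :
    truncated K ε f x
      = truncated K ε ((Ioc a b).indicator f) x + ∫ y in Ioi b, K (x - y) * f y := by
  have hi := hf.integrableOn x ε hε
  have e1 : truncated K ε ((Ioc a b).indicator f) x = ∫ y in Ioc (x + ε) b, K (x - y) * f y := by
    rw [truncated, setIntegral_eq_of_subset_of_forall_sdiff_eq_zero measurableSet_Ioi
      (show Ioc (x + ε) b ⊆ Ioi (x + ε) from Ioc_subset_Ioi_self)]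
    · refine setIntegral_congr_fun measurableSet_Ioc fun y hy => ?_
      rw [indicator_of_mem (show y ∈ Ioc a b from ⟨ha.trans_lt hy.1, hy.2⟩)]
    · intro y hy
      rw [indicator_of_notMem (fun h => hy.2 ⟨hy.1, h.2⟩), mul_zero]
  rw [e1, ← setIntegral_union (Ioc_disjoint_Ioi le_rfl) measurableSet_Ioi
    (hi.mono_set Ioc_subset_Ioi_self) (hi.mono_set (Ioi_subset_Ioi hb)), Ioc_union_Ioi_eq_Ioi hb]
  rfl

/-- The singular integral of an admissible function exists almost everywhere: near a point, the
truncations differ by a constant from those of an integrable function. -/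
theorem ae_tendsto_truncated (hK : IsSingularKernel K) {A : ℝ≥0 → ℝ≥0} (hA : IsYoung A)
    (hKA : Hormander (complementary A) K) {f : ℝ → ℝ} (hf : Admissible K f) :
    ∀ᵐ x : ℝ, Tendsto (fun ε => truncated K ε f x) (𝓝[>] 0) (𝓝 (singularIntegral K f x)) := by
  have hall : ∀ᵐ x : ℝ, ∀ n : ℕ, ∃ l,
      Tendsto (fun ε => truncated K ε ((Ioc (-(n : ℝ)) n).indicator f) x) (𝓝[>] 0) (𝓝 l) := by
    refine ae_all_iff.2 fun n => hK.ae_exists_tendsto_truncated_of_integrable hA hKA ?_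
    rw [integrable_indicator_iff measurableSet_Ioc]
    exact (hf.locallyIntegrable.integrableOn_isCompact isCompact_Icc).mono_set Ioc_subset_Icc_self
  filter_upwards [hall] with x hx
  obtain ⟨n, hn⟩ := exists_nat_gt |x|
  obtain ⟨l, hl⟩ := hx n
  refine tendsto_nhds_limUnder ⟨l + ∫ y in Ioi (n : ℝ), K (x - y) * f y, ?_⟩
  refine Tendsto.congr' ?_ (hl.add_const _)
  filter_upwards [Ioo_mem_nhdsGT (show 0 < (n : ℝ) - x by linarith [le_abs_self x])] with ε hε
  exact (truncated_eq_add hf hε.1 (by linarith [neg_abs_le x, hε.1]) (by linarith [hε.2])).symm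

theorem aemeasurable_singularIntegral (hK : IsSingularKernel K) {A : ℝ≥0 → ℝ≥0} (hA : IsYoung A)
    (hKA : Hormander (complementary A) K) {f : ℝ → ℝ} (hf : Admissible K f) :
    AEMeasurable (singularIntegral K f) volume := by
  have hm : ∀ ε, AEMeasurable (fun x => truncated K ε f x) volume := by
    intro ε
    have h1 : AEStronglyMeasurable (fun p : ℝ × ℝ => K (p.1 - p.2) * f p.2)
        (volume.prod volume) :=
      (hK.aesm.comp_quasiMeasurePreserving (quasiMeasurePreserving_sub volume volume)).mul
        hf.locallyIntegrable.aestronglyMeasurable.comp_snd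
    have h2 : MeasurableSet {p : ℝ × ℝ | p.1 + ε < p.2} :=
      measurableSet_lt (measurable_fst.add_const ε) measurable_snd
    refine (AEStronglyMeasurable.congr (h1.indicator h2).integral_prod_right' ?_).aemeasurable
    refine Eventually.of_forall fun x => ?_
    simp only [truncated]
    rw [← integral_indicator measurableSet_Ioi]
    rfl
  refine aemeasurable_of_tendsto_metrizable_ae atTop
    (f := fun (n : ℕ) x => truncated K (1 / ((n : ℝ) + 1)) f x) (fun n => hm _) ?_
  filter_upwards [hK.ae_tendsto_truncated hA hKA hf] with x hx
  refine hx.comp (tendsto_nhdsWithin_iff.2 ⟨tendsto_one_div_add_atTop_nhds_zero_nat, ?_⟩)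
  exact Eventually.of_forall fun n => by simp only [mem_Ioi]; positivity

end IsSingularKernel

/-! ### The pointwise inequality -/

section Orlicz

variable {A : ℝ≥0 → ℝ≥0} {f : ℝ → ℝ} {x : ℝ} {μ : ℝ≥0}

theorem lintegral_young_le_of_maximalOrlicz_lt (hA : IsYoung A) (hμ : maximalOrlicz A f x < μ)
    {h : ℝ} (hh : 0 < h) :
    ∫⁻ y in Icc x (x + h), (A (‖f y‖₊ / μ) : ℝ≥0∞) ≤ ENNReal.ofReal h := by
  have h1 : luxemburg (fun t => (A t : ℝ≥0∞)) (Icc x (x + h)) f < μ :=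
    (le_iSup₂ (f := fun (h : ℝ) (_ : 0 < h) =>
      luxemburg (fun t => (A t : ℝ≥0∞)) (Icc x (x + h)) f) h hh).trans_lt hμ
  simp only [luxemburg, iInf_lt_iff] at h1
  obtain ⟨r, hr, hle, hrμ⟩ := h1
  have hvol : volume (Icc x (x + h)) = ENNReal.ofReal h := by
    rw [Real.volume_Icc, add_sub_cancel_left]
  have h0 : ENNReal.ofReal h ≠ 0 := (ENNReal.ofReal_pos.2 hh).ne'
  rw [hvol] at hle
  have h2 := mul_le_mul_right hle (ENNReal.ofReal h)
  rw [← mul_assoc, ENNReal.mul_inv_cancel h0 ENNReal.ofReal_ne_top, one_mul, mul_one] at h2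
  refine le_trans (lintegral_mono fun y => ?_) h2
  have hrμ' : r ≤ μ := by exact_mod_cast hrμ.le
  exact ENNReal.coe_le_coe.2 (hA.monotone (by gcongr))

theorem lintegral_enorm_le_of_maximalOrlicz_lt (hA : IsYoung A) (hμ : maximalOrlicz A f x < μ)
    {h : ℝ} (hh : 0 < h) :
    ∫⁻ y in Icc x (x + h), ‖f y‖ₑ ≤ 2 * μ * ENNReal.ofReal h := by
  have hμ0 : μ ≠ 0 := by
    rintro rfl
    exact not_lt_zero hμ
  calc ∫⁻ y in Icc x (x + h), ‖f y‖ₑ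
      ≤ ∫⁻ y in Icc x (x + h), (μ : ℝ≥0∞) * (1 + (A (‖f y‖₊ / μ) : ℝ≥0∞)) := by
        refine lintegral_mono fun y => ?_
        have h1 := mul_le_mul_right (hA.le_one_add (‖f y‖₊ / μ)) μ
        rw [mul_div_cancel₀ _ hμ0] at h1
        rw [enorm_eq_nnnorm]
        simpa only [ENNReal.coe_mul, ENNReal.coe_add, ENNReal.coe_one] using ENNReal.coe_le_coe.2 h1
    _ = (μ : ℝ≥0∞) * (ENNReal.ofReal h
          + ∫⁻ y in Icc x (x + h), (A (‖f y‖₊ / μ) : ℝ≥0∞)) := by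
        rw [lintegral_const_mul' _ _ ENNReal.coe_ne_top, lintegral_add_left measurable_const,
          setLIntegral_const, one_mul, Real.volume_Icc, add_sub_cancel_left]
    _ ≤ (μ : ℝ≥0∞) * (ENNReal.ofReal h + ENNReal.ofReal h) := by
        gcongr
        exact lintegral_young_le_of_maximalOrlicz_lt hA hμ hh
    _ = _ := by ring

end Orlicz

/-- The far part of the singular integral, as a function of the base point, varies little between
`x` and points slightly to the right of `x`. This is where the Orlicz form of the Hörmander
condition is used: the function `f` need not be bounded. -/
theorem abs_truncated_sub_le {K : ℝ → ℝ} {A : ℝ≥0 → ℝ≥0} (hA : IsYoung A) {c C : ℝ≥0}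
    (hH : HormanderWith (complementary A) K c C)
    {f : ℝ → ℝ} (hf : Admissible K f) {x ε z : ℝ} {μ : ℝ≥0} (hμ : maximalOrlicz A f x < μ)
    (hε : 0 < ε) (hz : z < x + ε) (hcz : c * |z - x| < ε / 2) :
    |truncated K ε f x - ∫ y in Ioi (x + ε), K (z - y) * f y| ≤ 8 * C * μ := by
  have hμ0 : 0 < μ := by
    rw [pos_iff_ne_zero]
    rintro rfl
    exact not_lt_zero hμ
  have hfm := hf.locallyIntegrable.aestronglyMeasurable
  have hi : IntegrableOn (fun y => K (z - y) * f y) (Ioi (x + ε)) := by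
    have := hf.integrableOn z (x + ε - z) (by linarith)
    rwa [add_sub_cancel] at this
  have hmp := measurePreserving_add_left (volume : Measure ℝ) x
  set F : ℝ → ℝ := (Ici 0).indicator fun u => f (x + u) with hF
  have hFm : AEStronglyMeasurable F volume :=
    (hfm.comp_measurePreserving hmp).indicator measurableSet_Ici
  have hweight : ∀ m : ℕ, ∫⁻ u in Metric.ball 0 (2 ^ (m + 2) * (ε / 2)),
      (A (‖F u‖₊ / μ) : ℝ≥0∞) ≤ volume (Metric.ball (0 : ℝ) (2 ^ (m + 2) * (ε / 2))) := by
    intro m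
    set L : ℝ := 2 ^ (m + 2) * (ε / 2) with hL
    have hL0 : 0 < L := by positivity
    calc ∫⁻ u in Metric.ball 0 L, (A (‖F u‖₊ / μ) : ℝ≥0∞)
        ≤ ∫⁻ u in (fun u => x + u) ⁻¹' Icc x (x + L), (A (‖f (x + u)‖₊ / μ) : ℝ≥0∞) := by
          have hpre : (fun u => x + u) ⁻¹' Icc x (x + L) = Icc 0 L := by
            ext u
            simp
          rw [hpre, ← lintegral_indicator Metric.isOpen_ball.measurableSet,
            ← lintegral_indicator measurableSet_Icc]
          refine lintegral_mono fun u => ?_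
          by_cases hu : u ∈ Ici (0 : ℝ)
          · by_cases hub : u ∈ Metric.ball 0 L
            · have hub' := mem_ball_zero_iff.1 hub
              rw [Real.norm_eq_abs] at hub'
              rw [indicator_of_mem hub,
                indicator_of_mem (show u ∈ Icc 0 L from ⟨hu, (le_abs_self u).trans hub'.le⟩), hF,
                indicator_of_mem hu]
            · rw [indicator_of_notMem hub]
              exact zero_le
          · have : (A (‖F u‖₊ / μ) : ℝ≥0∞) = 0 := by
              simp [hF, indicator_of_notMem hu, hA.map_zero]
            refine (indicator_le_self' (fun _ _ => zero_le) u).trans ?_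
            rw [this]
            exact zero_le
      _ = ∫⁻ y in Icc x (x + L), (A (‖f y‖₊ / μ) : ℝ≥0∞) :=
          hmp.setLIntegral_comp_preimage_emb (MeasurableEquiv.addLeft x).measurableEmbedding
            (fun y => (A (‖f y‖₊ / μ) : ℝ≥0∞)) _
      _ ≤ ENNReal.ofReal L := lintegral_young_le_of_maximalOrlicz_lt hA hμ hL0
      _ ≤ _ := by
          rw [Real.volume_ball]
          exact ENNReal.ofReal_le_ofReal (by linarith)
  have h8 : (8 * C * μ : ℝ≥0∞) = ENNReal.ofReal (8 * C * μ) := by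
    rw [ENNReal.ofReal_mul (by positivity), ENNReal.ofReal_mul (by positivity),
      ENNReal.ofReal_coe_nnreal, ENNReal.ofReal_coe_nnreal, ENNReal.ofReal_ofNat]
  rw [← Real.norm_eq_abs, ← ENNReal.ofReal_le_ofReal_iff (by positivity), ofReal_norm, ← h8,
    truncated, ← integral_sub (hf.integrableOn x ε hε) hi]
  refine (enorm_integral_le_lintegral_enorm _).trans ?_
  calc ∫⁻ y in Ioi (x + ε), ‖K (x - y) * f y - K (z - y) * f y‖ₑ
      = ∫⁻ y in Ioi (x + ε), ‖K (x - y) - K (z - y)‖ₑ * ‖f y‖ₑ :=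
        lintegral_congr fun y => by rw [← sub_mul, enorm_mul]
    _ = ∫⁻ u in Ioi (2 * (ε / 2)), ‖K (z - x - u) - K (-u)‖ₑ * ‖F u‖ₑ := by
        rw [lintegral_Ioi_sub_kernel_mul K (fun y => ‖f y‖ₑ), mul_div_cancel₀ _ two_ne_zero]
        refine setLIntegral_congr_fun measurableSet_Ioi fun u hu => ?_
        simp only [hF]
        rw [indicator_of_mem (show u ∈ Ici (0 : ℝ) from (hε.trans hu).le)]
    _ ≤ _ := lintegral_hormander_mul_le hA hH hcz hFm hμ0 hweight

/-- The pointwise inequality of Cotlar type, with `μ` in place of the Orlicz maximal function: if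
the truncation at `x` is large compared with `μ`, then the singular integral is at least half as
large on at least half of a short interval to the right of `x`, by the weak type inequality for the
near part of the function. -/
theorem abs_truncated_le {K : ℝ → ℝ} {A : ℝ≥0 → ℝ≥0} (hA : IsYoung A)
    {c C : ℝ≥0} (hc : 1 ≤ c)
    (hH : HormanderWith (complementary A) K c C)
    {W : ℝ} (hW : 0 < W) (hweak : ∀ f : ℝ → ℝ, Integrable f → ∀ lam : ℝ, 0 < lam →
      volume {x | ∃ ε, 0 < ε ∧ lam < |truncated K ε f x|}
        ≤ ENNReal.ofReal (W / lam) * ∫⁻ y, ‖f y‖ₑ)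
    {f : ℝ → ℝ} (hf : Admissible K f) (hTm : AEMeasurable (singularIntegral K f) volume)
    (hT : ∀ᵐ x : ℝ, Tendsto (fun ε => truncated K ε f x) (𝓝[>] 0) (𝓝 (singularIntegral K f x)))
    {δ : ℝ} (hδ : 0 < δ) {x ε : ℝ} {μ : ℝ≥0} (hμ : maximalOrlicz A f x < μ) (hε : 0 < ε)
    (hbig : 2 * (8 * C + 8 * c * W) * μ < |truncated K ε f x|) :
    ENNReal.ofReal ((|truncated K ε f x| / 2) ^ δ)
      ≤ 2 * maximal (fun y => |singularIntegral K f y| ^ δ) x := by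
  have hc' : (1 : ℝ) ≤ c := by exact_mod_cast hc
  have hμ0 : 0 < (μ : ℝ) := by
    rw [NNReal.coe_pos, pos_iff_ne_zero]
    rintro rfl
    exact not_lt_zero hμ
  set t := |truncated K ε f x| with ht
  set a : ℝ := ε / (2 * c) with ha
  have ha0 : 0 < a := by positivity
  have haε : a ≤ ε := by
    rw [ha]
    exact div_le_self hε.le (by linarith)
  set f₁ : ℝ → ℝ := (Ioc x (x + ε)).indicator f with hf₁
  have hf₁i : Integrable f₁ := by
    rw [hf₁, integrable_indicator_iff measurableSet_Ioc]
    exact (hf.locallyIntegrable.integrableOn_isCompact isCompact_Icc).mono_set Ioc_subset_Icc_self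
  -- the height at which the exceptional set fills at most half of the interval
  set lam : ℝ := 8 * c * W * μ with hlam
  have hlam0 : 0 < lam := by positivity
  set bad : Set ℝ := {z | ∃ ε', 0 < ε' ∧ lam < |truncated K ε' f₁ z|} with hbad
  have hbadvol : volume bad ≤ ENNReal.ofReal (a / 2) := by
    refine (hweak f₁ hf₁i lam hlam0).trans ?_
    have h1 : ∫⁻ y, ‖f₁ y‖ₑ ≤ ENNReal.ofReal (2 * μ * ε) := by
      calc ∫⁻ y, ‖f₁ y‖ₑ = ∫⁻ y in Ioc x (x + ε), ‖f y‖ₑ := by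
            rw [← lintegral_indicator measurableSet_Ioc]
            exact lintegral_congr fun y => enorm_indicator_eq_indicator_enorm _ _
        _ ≤ ∫⁻ y in Icc x (x + ε), ‖f y‖ₑ := lintegral_mono_set Ioc_subset_Icc_self
        _ ≤ _ := lintegral_enorm_le_of_maximalOrlicz_lt hA hμ hε
        _ = _ := by
            rw [ENNReal.ofReal_mul (by positivity), ENNReal.ofReal_mul (by positivity),
              ENNReal.ofReal_coe_nnreal, ENNReal.ofReal_ofNat]
    refine (mul_le_mul_right h1 _).trans (le_of_eq ?_)
    rw [← ENNReal.ofReal_mul (by positivity)]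
    congr 1
    rw [hlam, ha]
    field_simp
    ring
  have hlarge : ∀ᵐ z : ℝ, z ∈ Ioo x (x + a) → z ∉ bad → t / 2 ≤ |singularIntegral K f z| := by
    filter_upwards [hT] with z hz hzI hzb
    have hzε : z < x + ε := by linarith [hzI.2]
    have hcz : c * |z - x| < ε / 2 := by
      rw [abs_of_pos (by linarith [hzI.1])]
      have : z - x < ε / (2 * c) := by linarith [hzI.2]
      rw [lt_div_iff₀ (by positivity)] at this
      linarith
    have h1 := abs_truncated_sub_le hA hH hf hμ hε hzε hcz
    have h2 : |singularIntegral K f z - ∫ y in Ioi (x + ε), K (z - y) * f y| ≤ lam := by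
      refine le_of_tendsto (hz.sub_const _).abs ?_
      filter_upwards [Ioo_mem_nhdsGT (show 0 < x + ε - z by linarith)] with ε' hε'
      rw [IsSingularKernel.truncated_eq_add hf hε'.1 (a := x) (b := x + ε)
        (by linarith [hzI.1, hε'.1]) (by linarith [hε'.2]), add_sub_cancel_right]
      by_contra hcon
      exact hzb ⟨ε', hε'.1, not_le.1 hcon⟩
    have h3 := abs_sub_abs_le_abs_sub (truncated K ε f x) (∫ y in Ioi (x + ε), K (z - y) * f y)
    have h4 := abs_sub_abs_le_abs_sub (∫ y in Ioi (x + ε), K (z - y) * f y) (singularIntegral K f z)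
    rw [abs_sub_comm] at h4
    have h5 : 2 * (8 * C + 8 * c * W) * μ = 2 * (8 * C * μ + lam) := by rw [hlam]; ring
    linarith
  set G : Set ℝ := {z | ENNReal.ofReal ((t / 2) ^ δ) ≤ ‖|singularIntegral K f z| ^ δ‖ₑ} with hG
  have hcover : ENNReal.ofReal a ≤ volume (G ∩ Icc x (x + a)) + ENNReal.ofReal (a / 2) := by
    calc ENNReal.ofReal a = volume (Ioo x (x + a)) := by
          rw [Real.volume_Ioo, add_sub_cancel_left]
      _ ≤ volume ((G ∩ Icc x (x + a)) ∪ bad) := by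
          refine measure_mono_ae ?_
          filter_upwards [hlarge] with z hz hzI
          by_cases hzb : z ∈ bad
          · exact Or.inr hzb
          · refine Or.inl ⟨?_, Ioo_subset_Icc_self hzI⟩
            rw [hG, mem_ofPred_eq, Real.enorm_eq_ofReal (by positivity)]
            exact ENNReal.ofReal_le_ofReal
              (Real.rpow_le_rpow (by positivity) (hz hzI hzb) hδ.le)
      _ ≤ _ := (measure_union_le _ _).trans (add_le_add_right hbadvol _)
  have hhalf : ENNReal.ofReal (a / 2) ≤ volume (G ∩ Icc x (x + a)) := by
    rw [← add_halves a, ENNReal.ofReal_add (by positivity) (by positivity), add_halves a] at hcover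
    exact (ENNReal.add_le_add_iff_right ENNReal.ofReal_ne_top).1 hcover
  have hmarkov : ENNReal.ofReal ((t / 2) ^ δ) * volume (G ∩ Icc x (x + a))
      ≤ ∫⁻ z in Icc x (x + a), ‖|singularIntegral K f z| ^ δ‖ₑ := by
    refine le_trans (mul_le_mul_right (Measure.le_restrict_apply _ _) _)
      (mul_meas_ge_le_lintegral₀ ?_ _)
    exact ((hTm.norm.pow_const δ).enorm).restrict
  have hmax : (ENNReal.ofReal a)⁻¹ * ∫⁻ z in Icc x (x + a), ‖|singularIntegral K f z| ^ δ‖ₑ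
      ≤ maximal (fun y => |singularIntegral K f y| ^ δ) x :=
    le_iSup₂ (f := fun (h : ℝ) (_ : 0 < h) => (ENNReal.ofReal h)⁻¹ *
      ∫⁻ z in Icc x (x + h), ‖|singularIntegral K f z| ^ δ‖ₑ) a ha0
  have ha' : ENNReal.ofReal a ≠ 0 := (ENNReal.ofReal_pos.2 ha0).ne'
  calc ENNReal.ofReal ((t / 2) ^ δ)
      = 2 * ((ENNReal.ofReal a)⁻¹ * (ENNReal.ofReal ((t / 2) ^ δ) * ENNReal.ofReal (a / 2))) := by
        rw [← ENNReal.ofReal_inv_of_pos ha0, ← ENNReal.ofReal_mul (by positivity),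
          ← ENNReal.ofReal_mul (by positivity), ← ENNReal.ofReal_ofNat,
          ← ENNReal.ofReal_mul (by norm_num)]
        congr 1
        field_simp
    _ ≤ 2 * ((ENNReal.ofReal a)⁻¹ * ∫⁻ z in Icc x (x + a), ‖|singularIntegral K f z| ^ δ‖ₑ) := by
        gcongr
        exact (mul_le_mul_right hhalf _).trans hmarkov
    _ ≤ _ := by gcongr

theorem maximalSingularIntegral_le {K : ℝ → ℝ} (hK : IsSingularKernel K) {A : ℝ≥0 → ℝ≥0}
    (hA : IsYoung A) (hKA : Hormander (complementary A) K) {δ : ℝ} (hδ : 0 < δ) :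
    ∃ C : ℝ≥0, ∀ f : ℝ → ℝ, Admissible K f → ∀ x : ℝ,
      maximalSingularIntegral K f x ≤
        (C : ℝ≥0∞) * (maximalPow δ (singularIntegral K f) x + maximalOrlicz A f x) := by
  obtain ⟨W, hW, hweak⟩ := hK.exists_volume_maximal_gt_le hA hKA
  have hKA' := hKA
  obtain ⟨c, C, hc, hC, hH⟩ := hKA'
  lift W to ℝ≥0 using hW.le
  have hδ' : 0 < 1 / δ := by positivity
  set D : ℝ≥0 := 2 * 2 ^ (1 / δ) + 2 * (8 * C + 8 * c * W) with hD
  have hD0 : 0 < D := by positivity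
  refine ⟨D, fun f hf x => iSup₂_le fun ε hε => ?_⟩
  have hstep : ∀ μ : ℝ≥0, maximalOrlicz A f x < μ →
      ‖truncated K ε f x‖ₑ ≤ D * (maximalPow δ (singularIntegral K f) x + μ) := by
    intro μ hμ
    rcases le_or_gt |truncated K ε f x| (2 * (8 * C + 8 * c * W) * μ) with h | h
    · calc ‖truncated K ε f x‖ₑ ≤ ENNReal.ofReal (2 * (8 * C + 8 * c * W) * μ) := by
            rw [Real.enorm_eq_ofReal_abs]
            exact ENNReal.ofReal_le_ofReal h
        _ = ((2 * (8 * C + 8 * c * W) * μ : ℝ≥0) : ℝ≥0∞) := by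
            rw [← ENNReal.ofReal_coe_nnreal]
            push_cast
            rfl
        _ ≤ ((D * μ : ℝ≥0) : ℝ≥0∞) := by
            refine ENNReal.coe_le_coe.2 (mul_le_mul_left ?_ _)
            rw [hD]
            exact le_add_of_nonneg_left zero_le
        _ ≤ _ := by
            rw [ENNReal.coe_mul]
            gcongr
            exact le_add_left le_rfl
    · have h1 := abs_truncated_le hA hc hH hW hweak hf (hK.aemeasurable_singularIntegral hA hKA hf)
        (hK.ae_tendsto_truncated hA hKA hf) hδ hμ hε h
      have h2 := ENNReal.rpow_le_rpow h1 hδ'.le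
      rw [ENNReal.ofReal_rpow_of_nonneg (by positivity) hδ'.le, ← Real.rpow_mul (by positivity),
        mul_one_div_cancel hδ.ne', Real.rpow_one, ENNReal.mul_rpow_of_nonneg _ _ hδ'.le] at h2
      calc ‖truncated K ε f x‖ₑ = 2 * ENNReal.ofReal (|truncated K ε f x| / 2) := by
            rw [Real.enorm_eq_ofReal_abs, ← ENNReal.ofReal_ofNat, ← ENNReal.ofReal_mul (by norm_num),
              mul_div_cancel₀ _ two_ne_zero]
        _ ≤ 2 * (2 ^ (1 / δ) * maximalPow δ (singularIntegral K f) x) := by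
            gcongr
            exact h2
        _ = ((2 * 2 ^ (1 / δ) : ℝ≥0) : ℝ≥0∞) * maximalPow δ (singularIntegral K f) x := by
            rw [ENNReal.coe_mul, ENNReal.coe_rpow_of_nonneg _ hδ'.le]
            push_cast
            ring
        _ ≤ _ := by
            gcongr
            · rw [hD]
              exact le_add_of_nonneg_right zero_le
            · exact le_add_right le_rfl
  clear_value D
  by_cases htop : maximalOrlicz A f x = ∞
  · rw [htop, add_top, ENNReal.mul_top (by exact_mod_cast hD0.ne')]
    exact le_top
  refine ENNReal.le_of_forall_pos_le_add fun η hη _ => ?_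
  have hlt : maximalOrlicz A f x < ((maximalOrlicz A f x).toNNReal + η / D : ℝ≥0) := by
    rw [ENNReal.coe_add, ENNReal.coe_toNNReal htop]
    exact ENNReal.lt_add_right htop (by exact_mod_cast (div_pos hη hD0).ne')
  refine (hstep _ hlt).trans (le_of_eq ?_)
  rw [ENNReal.coe_add, ENNReal.coe_toNNReal htop, ← add_assoc, mul_add]
  congr 1
  rw [← ENNReal.coe_mul, mul_div_cancel₀ _ hD0.ne']

end OneSided

theorem theorem16 (A : ℝ≥0 → ℝ≥0) (hA : OneSided.IsYoung A)
    (K : ℝ → ℝ) (hK : OneSided.IsSingularKernel K)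
    (hKA : OneSided.Hormander (OneSided.complementary A) K) :
    (∀ f : ℝ → ℝ, OneSided.Admissible K f →
      ∀ᵐ x : ℝ, Tendsto (fun ε : ℝ => OneSided.truncated K ε f x) (𝓝[>] 0)
        (𝓝 (OneSided.singularIntegral K f x))) ∧
    ∀ δ : ℝ, 0 < δ → δ < 1 → ∃ C : ℝ≥0, ∀ f : ℝ → ℝ, OneSided.Admissible K f → ∀ x : ℝ,
      OneSided.maximalSingularIntegral K f x ≤
        (C : ℝ≥0∞) * (OneSided.maximalPow δ (OneSided.singularIntegral K f) x
          + OneSided.maximalOrlicz A f x) :=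
  ⟨fun _ hf => hK.ae_tendsto_truncated hA hKA hf,
    fun _ hδ _ => OneSided.maximalSingularIntegral_le hK hA hKA hδ⟩
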